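/- **Setting.** Let $I=[0,1]$ and let $K\subset[0,1]$ be the middle third Cantor set. Put $K_\varnothing=K$ and, for a finite binary string $a$, $K_{0a}=\tfrac13K_a$ and $K_{1a}=\tfrac13K_a+\tfrac23$. For $n\ge 1$ let $$J_n=\Big\{\sum_{i=1}^n m_i3^{-i} : m_i\in\{0,1,2\},\ m_n>0\Big\}\subset(0,1).$$ Let $F=(I\times K)/\sim$, where $\sim$ is the equivalence relation generated by $(x_1,x_2)\sim(x_1,x_2+2\cdot 3^{-n})$ for all $n\ge1$, $x_1\in J_n$ and $x_2\in K_{a0}$ with $a$ a binary string of length $n-1$. Let $q\colon I\times K\to F$, $q(x_1,x_2)=[x_1,x_2]$, be the quotient map, let $h[x_1,x_2]=x_1$ be the height, and equip $F$ with the metric $$d(x,y)=\inf\{\mathcal H^1(p) : p\subset I\times K,\ q(p)\text{ is a path joining }x\text{ and }y\}.$$ $(F,d)$ is Laakso space; put $Q=1+\frac{\ln 2}{\ln 3}$. The points $[x_1,x_2]$ with $x_1\in\bigcup_nJ_n$ (which have exactly two representatives in $I\times K$) are called wormholes. For $f\colon F\to\mathbb R$ and $x\in F$, the directional derivative $f_I(x)$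 exists and equals $L$ if $$\lim_{t\to0}\frac{f[x_1+t,x_2]-f[x_1,x_2]}{t}=L$$ (over $t\neq 0$ with $x_1+t\in I$) for the unique representative $(x_1,x_2)$ of $x$ if $x$ is not a wormhole, respectively for both representatives of $x$ if $x$ is a wormhole. The function $f$ is differentiable at $x$ if there is $D\in\mathbb R$ such that $$\lim_{y\to x}\frac{f(y)-f(x)-D\,(h(y)-h(x))}{d(y,x)}=0.$$ For $f$ Lipschitz, $\mathrm{Lip}(f)$ is its smallest Lipschitz constant. For $t\in(0,1)$ and $n\geq 1$ let $D_n^{+}(t)=\inf\{s>0: t+s\in J_n\}$ and $D_n^{-}(t)=\inf\{s>0:t-s\in J_n\}$ (with $\inf\varnothing=\infty$; both are finite for all large $n$). Let $S$ be the set of $t\in(0,1)$ for which there are $C\ge1$ and $N\in\mathbb N$ with $$C^{-1}\le \frac{D_n^+(t)}{D_n^-(t)}\le C\qquad\text{for all }n\ge N.$$ A set $P$ in a metric space $X$ is porous if there is $0<\rho<1$ such that for all $x\in P$ and $\delta>0$ there is $y\in X$ with $0<d(y,x)<\delta$ and $B(y,\rho\,d(y,x))\cap P=\varnothing$; a set is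 $\sigma$-porous if it is a countable union of porous sets. **Theorem 1.1.** Let $M$ be the set of all $x\in F$ such that every Lipschitz $f\colon F\to\mathbb R$ for which $f_I(x)$ exists and $|f_I(x)|=\mathrm{Lip}(f)$ is differentiable at $x$. Then $$M=\{[x_1,x_2] : x_1\in S\}.$$ In particular $M$ is $\sigma$-porous in $(F,d)$; hence it is of first category (meagre) and $\mathcal H^{Q}(M)=0$. -/

import Mathlib

open Set Filter Topology MeasureTheory
open scoped NNReal ENNReal

noncomputable section

namespace Laakso

/-! ### The product `I × K` and the wormhole identifications -/

/-- The product `I × K` of the unit interval and the middle third Cantor set. -/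
abbrev IK : Type := ↥(Icc (0 : ℝ) 1) × ↥cantorSet

/-- The copy `K_a` of the Cantor set associated with a finite binary string `a`:
`K_∅ = K`, `K_{0a} = K_a / 3`, `K_{1a} = K_a / 3 + 2 / 3`. -/
def cantorCopy : List Bool → Set ℝ
  | [] => cantorSet
  | b :: a => (fun x : ℝ => x / 3 + if b then 2 / 3 else 0) '' cantorCopy a

/-- The set `J_n` of the heights `w(m₁, …, m_n) = ∑ m_i / 3^i`, `m_i ∈ {0, 1, 2}`, `m_n > 0`, of
the wormhole levels of order `n ≥ 1` (the digit `m_{i+1}` is `m i`). There are none of order `0`. -/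
def wormholeHeights (n : ℕ) : Set ℝ :=
  {t | ∃ m : Fin n → Fin 3, (∃ i : Fin n, i.val + 1 = n ∧ 0 < m i) ∧
    t = ∑ i : Fin n, ((m i).val : ℝ) / 3 ^ (i.val + 1)}

/-- `(x₁, x₂)` with `x₁ ∈ J_n` and `x₂ ∈ K_{a0}`, `a` of length `n - 1`, is identified with
`(x₁, x₂ + 2 / 3^n)`. -/
def WormholeStep (p r : IK) : Prop :=
  ∃ (n : ℕ) (a : List Bool), a.length + 1 = n ∧ (p.1 : ℝ) ∈ wormholeHeights n ∧
    (p.2 : ℝ) ∈ cantorCopy (a ++ [false]) ∧ r.1 = p.1 ∧ (r.2 : ℝ) = (p.2 : ℝ) + 2 / 3 ^ n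

/-- The quotient of `I × K` by the equivalence relation generated by the identifications. It
carries the quotient topology. -/
abbrev WormholeQuotient : Type := Quot WormholeStep

/-- The one-dimensional Hausdorff measure of `p ⊆ I × K` for the Euclidean distance of the plane. -/
def hausdorffLength (p : Set IK) : ℝ≥0∞ :=
  μH[1] ((fun z : IK => (!₂[(z.1 : ℝ), (z.2 : ℝ)] : EuclideanSpace ℝ (Fin 2))) '' p)

/-- `d(x, y) = inf {H¹(p) : p ⊆ I × K, q(p) is a path joining x and y}`, a priori in `[0, ∞]`. -/
def pathEDist (x y : WormholeQuotient) : ℝ≥0∞ :=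
  ⨅ (p : Set IK) (_ : ∃ γ : Path x y, range γ = Quot.mk WormholeStep '' p), hausdorffLength p

/-- The height on the quotient. -/
def quotHeight : WormholeQuotient → ℝ :=
  Quot.lift (fun p : IK => (p.1 : ℝ)) (by
    rintro p r ⟨n, a, -, -, -, h, -⟩
    simp [h])

/-! ### The path distance is a metric -/

/-- The sequence of ternary digits of a point of `K`, with `true` for `2`. -/
def bits (z : cantorSet) : ℕ → Bool := cantorSetHomeomorphNatToBool z

/-- The point of `K` with given ternary digits. -/
def ofBits (b : ℕ → Bool) : cantorSet := cantorSetHomeomorphNatToBool.symm b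

theorem bits_ofBits (b : ℕ → Bool) : bits (ofBits b) = b :=
  cantorSetHomeomorphNatToBool.apply_symm_apply b

theorem ofBits_bits (z : cantorSet) : ofBits (bits z) = z :=
  cantorSetHomeomorphNatToBool.symm_apply_apply z

theorem ofBits_val (b : ℕ → Bool) :
    (ofBits b : ℝ) = Real.ofDigits (fun i => cond (b i) (2 : Fin 3) 0) := rfl

theorem ofBits_injective {b c : ℕ → Bool} (h : (ofBits b : ℝ) = ofBits c) : b = c :=
  cantorSetHomeomorphNatToBool.symm.injective (Subtype.ext h)

theorem ofBits_rec (b : ℕ → Bool) :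
    (ofBits b : ℝ) = (ofBits fun i => b (i + 1) : ℝ) / 3 + if b 0 then 2 / 3 else 0 := by
  rw [ofBits_val, Real.ofDigits_eq_sum_add_ofDigits _ 1, ofBits_val]
  cases h : b 0 <;> simp [Real.ofDigitsTerm, h] <;> ring

theorem mem_cantorCopy (a : List Bool) (b : ℕ → Bool) :
    (ofBits b : ℝ) ∈ cantorCopy a ↔ ∀ (i : ℕ) (hi : i < a.length), b i = a[i] := by
  induction a generalizing b with
  | nil => simp [cantorCopy]
  | cons c a ih =>
    constructor
    · rintro ⟨x, hx, hxb⟩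
      have hxK : x ∈ cantorSet := by
        clear hxb ih
        induction a generalizing x with
        | nil => exact hx
        | cons d a ih2 =>
          obtain ⟨y, hy, rfl⟩ := hx
          have := ih2 y hy
          rw [cantorSet_eq_union_halves]
          cases d
          · left; exact ⟨y, this, by simp⟩
          · right; exact ⟨y, this, by simp; ring⟩
      obtain ⟨b', hb'⟩ : ∃ b', (ofBits b' : ℝ) = x := ⟨bits ⟨x, hxK⟩, by rw [ofBits_bits]⟩
      subst hb'
      obtain ⟨B, hB0, hB⟩ : ∃ B : ℕ → Bool, B 0 = c ∧ (fun i => B (i + 1)) = b' :=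
        ⟨fun i => Nat.casesOn i c b', rfl, rfl⟩
      have hbB : b = B := by
        apply ofBits_injective
        rw [ofBits_rec B, hB, hB0]
        exact hxb.symm
      subst hbB
      intro i hi
      cases i with
      | zero => simpa using hB0
      | succ i =>
        have := (ih b').1 hx i (by simpa using hi)
        rw [← hB] at this
        exact this
    · intro h
      refine ⟨ofBits fun i => b (i + 1), (ih _).2 fun i hi => ?_, ?_⟩
      · exact h (i + 1) (by simpa using hi)
      · rw [ofBits_rec b]
        have := h 0 (by simp)
        simp at this
        simp [this]

theorem ofBits_update (k : ℕ) (b : ℕ → Bool) (hb : b k = false) :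
    (ofBits (Function.update b k true) : ℝ) = ofBits b + 2 / 3 ^ (k + 1) := by
  induction k generalizing b with
  | zero =>
    rw [ofBits_rec, ofBits_rec b]
    simp [hb]
  | succ k ih =>
    rw [ofBits_rec, ofBits_rec b]
    have h1 : (fun i => Function.update b (k + 1) true (i + 1))
        = Function.update (fun i => b (i + 1)) k true := by
      ext i
      by_cases h : i = k <;> simp [h]
    rw [h1, ih _ hb]
    simp
    ring

/-- The identification of order `k + 1` changes exactly the digit of index `k`. -/
theorem wormholeStep_iff (p r : IK) : WormholeStep p r ↔
    ∃ k : ℕ, (p.1 : ℝ) ∈ wormholeHeights (k + 1) ∧ bits p.2 k = false ∧ r.1 = p.1 ∧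
      bits r.2 = Function.update (bits p.2) k true := by
  constructor
  · rintro ⟨n, a, rfl, hJ, hK, h1, h2⟩
    have hb : bits p.2 a.length = false := by
      rw [← ofBits_bits p.2, mem_cantorCopy] at hK
      simpa using hK a.length (by simp)
    refine ⟨a.length, hJ, hb, h1, ?_⟩
    apply ofBits_injective
    rw [ofBits_update _ _ hb, ofBits_bits, ofBits_bits, h2]
  · rintro ⟨k, hJ, hb, h1, h2⟩
    refine ⟨k + 1, List.ofFn fun i : Fin k => bits p.2 i, by simp, hJ, ?_, h1, ?_⟩
    · rw [← ofBits_bits p.2, mem_cantorCopy]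
      intro i hi
      simp at hi
      by_cases hik : i = k
      · subst hik; simp [hb, ofBits_bits]
      · have : i < k := by omega
        simp [this, ofBits_bits]
    · rw [← ofBits_bits r.2, h2, ofBits_update _ _ hb, ofBits_bits]

theorem wormholeHeights_finite (n : ℕ) : (wormholeHeights n).Finite := by
  refine (finite_range fun m : Fin n → Fin 3 =>
    ∑ i : Fin n, ((m i).val : ℝ) / 3 ^ (i.val + 1)).subset ?_
  rintro t ⟨m, -, rfl⟩
  exact ⟨m, rfl⟩

theorem wormholeHeights_int {n : ℕ} {t : ℝ} (ht : t ∈ wormholeHeights (n + 1)) :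
    ∃ k : ℕ, t * 3 ^ (n + 1) = k ∧ ¬ 3 ∣ k := by
  obtain ⟨m, ⟨i, hi, hm⟩, rfl⟩ := ht
  have hil : i = Fin.last n := Fin.ext (by simpa using hi)
  subst hil
  refine ⟨3 * (∑ i : Fin n, (m i.castSucc).val * 3 ^ (n - 1 - i.val)) + (m (Fin.last n)).val,
    ?_, ?_⟩
  · rw [Fin.sum_univ_castSucc]
    push_cast
    rw [add_mul, Finset.sum_mul, Finset.mul_sum]
    congr 1
    · refine Finset.sum_congr rfl fun i _ => ?_
      have h : (3 : ℝ) ^ (n + 1) = 3 ^ (i.val + 1) * 3 * 3 ^ (n - 1 - i.val) := by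
        rw [← pow_succ, ← pow_add]
        congr 1
        omega
      rw [h, Fin.val_castSucc]
      field_simp
    · simp
  · have h1 : (m (Fin.last n)).val < 3 := (m (Fin.last n)).isLt
    have h2 : 0 < (m (Fin.last n)).val := hm
    omega

theorem wormholeHeights_disjoint {m n : ℕ} {t : ℝ} (hm : t ∈ wormholeHeights (m + 1))
    (hn : t ∈ wormholeHeights (n + 1)) : m = n := by
  wlog h : m < n generalizing m n
  · by_contra hne
    exact hne (this hn hm (by omega)).symm
  exfalso
  obtain ⟨k, hk, -⟩ := wormholeHeights_int hm
  obtain ⟨l, hl, h3⟩ := wormholeHeights_int hn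
  obtain ⟨d, rfl⟩ : ∃ d, n = m + d + 1 := ⟨n - m - 1, by omega⟩
  apply h3
  refine ⟨k * 3 ^ d, ?_⟩
  have : (l : ℝ) = ((3 * (k * 3 ^ d) : ℕ) : ℝ) := by
    push_cast
    rw [← hl, ← hk]
    ring
  exact_mod_cast this

theorem pow_mem_wormholeHeights (k : ℕ) : ((1 : ℝ) / 3 ^ (k + 1)) ∈ wormholeHeights (k + 1) := by
  refine ⟨fun i => if i = Fin.last k then 1 else 0, ⟨Fin.last k, by simp, by simp⟩, ?_⟩
  rw [Fin.sum_univ_castSucc]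
  simp [(Fin.castSucc_lt_last _).ne]

theorem quotHeight_mk (p : IK) : quotHeight (Quot.mk _ p) = p.1 := rfl

theorem continuous_quotHeight : Continuous quotHeight :=
  continuous_quot_lift _ (by fun_prop)

/-- The length of `p` is at least the length of every interval covered by its heights. -/
theorem le_hausdorffLength {x y : WormholeQuotient} (γ : Path x y) {p : Set IK}
    (hp : range γ = Quot.mk WormholeStep '' p) (s t : unitInterval) :
    ENNReal.ofReal |quotHeight (γ s) - quotHeight (γ t)| ≤ hausdorffLength p := by
  have hsub : uIcc (quotHeight (γ s)) (quotHeight (γ t)) ⊆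
      (fun v : EuclideanSpace ℝ (Fin 2) => v 0) ''
        ((fun z : IK => (!₂[(z.1 : ℝ), (z.2 : ℝ)] : EuclideanSpace ℝ (Fin 2))) '' p) := by
    have hconn : IsPreconnected (range fun r => quotHeight (γ r)) :=
      isPreconnected_range (continuous_quotHeight.comp γ.continuous)
    intro c hc
    obtain ⟨r, hr⟩ := hconn.ordConnected.uIcc_subset (mem_range_self s) (mem_range_self t) hc
    have : γ r ∈ Quot.mk WormholeStep '' p := hp ▸ mem_range_self r
    obtain ⟨z, hz, hzr⟩ := this
    refine ⟨_, ⟨z, hz, rfl⟩, ?_⟩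
    simp only at hr
    rw [← hr, ← hzr, quotHeight_mk]
    simp
  have hlip : LipschitzWith 1 (fun v : EuclideanSpace ℝ (Fin 2) => v 0) := by
    refine LipschitzWith.of_dist_le_mul fun v w => ?_
    simpa [dist_eq_norm] using PiLp.norm_apply_le (v - w) 0
  calc ENNReal.ofReal |quotHeight (γ s) - quotHeight (γ t)|
      = volume (uIcc (quotHeight (γ s)) (quotHeight (γ t))) := by
        rw [Real.volume_interval, abs_sub_comm]
    _ ≤ _ := measure_mono hsub
    _ = _ := by rw [← hausdorffMeasure_real]
    _ ≤ _ := hlip.hausdorffMeasure_image_le zero_le_one _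
    _ = hausdorffLength p := by simp [hausdorffLength]

theorem pathEDist_self (x : WormholeQuotient) : pathEDist x x = 0 := by
  obtain ⟨p, rfl⟩ := Quot.exists_rep x
  refine le_antisymm ((iInf₂_le {p} ⟨Path.refl _, by simp⟩).trans ?_) zero_le
  have := Measure.nullSingletonClass_hausdorff (EuclideanSpace ℝ (Fin 2)) (zero_lt_one' ℝ)
  simp [hausdorffLength]

theorem pathEDist_comm_le (x y : WormholeQuotient) : pathEDist x y ≤ pathEDist y x := by
  refine le_iInf₂ fun p hp => ?_
  obtain ⟨γ, hγ⟩ := hp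
  exact iInf₂_le p ⟨γ.symm, by rw [Path.symm_range, hγ]⟩

theorem pathEDist_triangle (x y z : WormholeQuotient) :
    pathEDist x z ≤ pathEDist x y + pathEDist y z := by
  have key : ∀ p : {p : Set IK // ∃ γ : Path x y, range γ = Quot.mk WormholeStep '' p},
      ∀ r : {r : Set IK // ∃ γ : Path y z, range γ = Quot.mk WormholeStep '' r},
      pathEDist x z ≤ hausdorffLength p.1 + hausdorffLength r.1 := by
    rintro ⟨p, γ, hγ⟩ ⟨r, γ', hγ'⟩
    refine (iInf₂_le (p ∪ r) ⟨γ.trans γ', by rw [Path.trans_range, hγ, hγ', image_union]⟩).trans ?_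
    rw [hausdorffLength, image_union]
    exact measure_union_le _ _
  have hxy : pathEDist x y = _ := iInf_subtype'
  have hyz : pathEDist y z = _ := iInf_subtype'
  rw [hxy, hyz, ENNReal.iInf_add]
  refine le_iInf fun p => ?_
  rw [ENNReal.add_iInf]
  exact le_iInf fun r => key p r

theorem eq_of_pathEDist_eq_zero {x y : WormholeQuotient} (h : pathEDist x y = 0) : x = y := by
  have short : ∀ δ : ℝ, 0 < δ → ∃ γ : Path x y, ∀ s, |quotHeight (γ s) - quotHeight x| < δ := by
    intro δ hδ
    have : pathEDist x y < ENNReal.ofReal δ := by rw [h]; simpa using hδ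
    simp only [pathEDist, iInf_lt_iff] at this
    obtain ⟨p, ⟨γ, hγ⟩, hp⟩ := this
    refine ⟨γ, fun s => ?_⟩
    have := (le_hausdorffLength γ hγ s 0).trans_lt hp
    rw [γ.source] at this
    exact (ENNReal.ofReal_lt_ofReal_iff hδ).1 this
  obtain ⟨⟨t, u⟩, rfl⟩ := Quot.exists_rep x
  obtain ⟨⟨t', v⟩, rfl⟩ := Quot.exists_rep y
  have ht : t' = t := by
    apply Subtype.ext
    apply eq_of_forall_dist_le
    intro δ hδ
    obtain ⟨γ, hγ⟩ := short δ hδ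
    have := hγ 1
    rw [γ.target] at this
    exact this.le
  subst ht
  -- a digit can only differ if the height is a wormhole level of the corresponding order
  have hbit : ∀ k, (t' : ℝ) ∉ wormholeHeights (k + 1) → bits u k = bits v k := by
    intro k hk
    obtain ⟨δ, hδ, hball⟩ := Metric.isOpen_iff.1
      (wormholeHeights_finite (k + 1)).isClosed.isOpen_compl t' hk
    obtain ⟨γ, hγ⟩ := short δ hδ
    let U : Bool → Set WormholeQuotient := fun b => {w | Quot.lift
      (fun p : IK => |(p.1 : ℝ) - t'| < δ ∧ bits p.2 k = b) (by
        intro p r hpr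
        obtain ⟨j, hj, hb, h1, h2⟩ := (wormholeStep_iff p r).1 hpr
        rw [h1]
        refine propext (and_congr_right fun hp => ?_)
        have : k ≠ j := by
          rintro rfl
          exact hball (by simpa [Real.dist_eq] using hp) hj
        rw [h2, Function.update_of_ne this]) w}
    have hU : ∀ b, IsOpen (U b) := by
      intro b
      rw [← isQuotientMap_quot_mk.isOpen_preimage]
      have h1 : Continuous fun p : IK => bits p.2 k :=
        (continuous_apply k).comp (cantorSetHomeomorphNatToBool.continuous.comp continuous_snd)
      have h2 : Continuous fun p : IK => |(p.1 : ℝ) - t'| := by fun_prop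
      exact (isOpen_lt h2 continuous_const).inter ((isOpen_discrete {b}).preimage h1)
    by_contra hne
    have hcov : range γ ⊆ U (bits u k) ∪ U (bits v k) := by
      rintro _ ⟨s, rfl⟩
      have hs := hγ s
      obtain ⟨p, hp⟩ := Quot.exists_rep (γ s)
      rw [← hp] at hs ⊢
      by_cases hpu : bits p.2 k = bits u k
      · exact Or.inl ⟨hs, hpu⟩
      · refine Or.inr ⟨hs, ?_⟩
        cases h1 : bits p.2 k <;> cases h2 : bits u k <;> cases h3 : bits v k <;> simp_all
    have hpre : IsPreconnected (range γ) := isPreconnected_range γ.continuous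
    obtain ⟨w, -, hwu, hwv⟩ := hpre _ _ (hU (bits u k)) (hU (bits v k)) hcov
      ⟨_, ⟨0, γ.source⟩, by simpa using hδ, rfl⟩ ⟨_, ⟨1, γ.target⟩, by simpa using hδ, rfl⟩
    obtain ⟨p, rfl⟩ := Quot.exists_rep w
    exact hne (hwu.2.symm.trans hwv.2)
  by_cases huv : u = v
  · rw [huv]
  have hbne : bits u ≠ bits v := fun h => huv (by rw [← ofBits_bits u, h, ofBits_bits])
  obtain ⟨k, hk⟩ := Function.ne_iff.1 hbne
  have hkt : (t' : ℝ) ∈ wormholeHeights (k + 1) := by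
    by_contra hc
    exact hk (hbit k hc)
  have hother : ∀ i, i ≠ k → bits u i = bits v i := fun i hi =>
    hbit i fun hc => hi (wormholeHeights_disjoint hc hkt)
  cases hu : bits u k
  · refine Quot.sound ((wormholeStep_iff _ _).2 ⟨k, hkt, hu, rfl, ?_⟩)
    ext i
    by_cases hi : i = k
    · subst hi
      cases hv : bits v i <;> simp_all
    · simp [hi, hother i hi]
  · refine (Quot.sound ((wormholeStep_iff (t', v) (t', u)).2 ⟨k, hkt, ?_, rfl, ?_⟩)).symm
    · cases hv : bits v k <;> simp_all
    · ext i
      by_cases hi : i = k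
      · subst hi
        simp [hu]
      · simp [hi, hother i hi]

theorem hausdorffLength_vertical_le (u : cantorSet) (A : Set ℝ) :
    hausdorffLength {z | z.2 = u ∧ (z.1 : ℝ) ∈ A} ≤ volume A := by
  have hlip : LipschitzWith 1 (fun s : ℝ => (!₂[s, (u : ℝ)] : EuclideanSpace ℝ (Fin 2))) := by
    refine LipschitzWith.of_dist_le_mul fun v w => ?_
    simp [EuclideanSpace.dist_eq]
  have := hlip.hausdorffMeasure_image_le zero_le_one A
  rw [hausdorffMeasure_real] at this
  simp only [ENNReal.coe_one, ENNReal.one_rpow, one_mul] at this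
  refine le_trans (measure_mono ?_) this
  rintro _ ⟨z, ⟨hz, hA⟩, rfl⟩
  exact ⟨z.1, hA, by simp [hz]⟩

theorem pathEDist_ne_top_of_curve (g : unitInterval → IK)
    (hc : Continuous fun s => Quot.mk WormholeStep (g s)) (hl : hausdorffLength (range g) ≠ ⊤) :
    pathEDist (Quot.mk _ (g 0)) (Quot.mk _ (g 1)) ≠ ⊤ := by
  refine ne_top_of_le_ne_top hl (iInf₂_le (range g) ⟨⟨⟨_, hc⟩, rfl, rfl⟩, ?_⟩)
  rw [← range_comp]
  rfl

/-- The points of the line over `u` are at finite distance from its lowest point. -/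
theorem pathEDist_line_ne_top (t : Icc (0 : ℝ) 1) (u : cantorSet) :
    pathEDist (Quot.mk _ (0, u)) (Quot.mk _ (t, u)) ≠ ⊤ := by
  have := pathEDist_ne_top_of_curve (fun s : unitInterval => (s * t, u))
    (continuous_quot_mk.comp (by fun_prop)) (by
      refine ne_top_of_le_ne_top ?_ ((measure_mono (image_mono ?_)).trans
        (hausdorffLength_vertical_le u (Icc 0 1)))
      · simp
      · rintro _ ⟨s, rfl⟩
        exact ⟨rfl, (s * t).2⟩)
  simpa using this

/-- Going up from height `0` to height `1 / 3` one can jump at the heights `1 / 3 ^ (k + 1)`,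
`k = 0, 1, …`, and thereby change every digit `2` to `0`. -/
def climb (u : ℕ → Bool) (s : unitInterval) : IK :=
  (⟨s / 3, by have := s.2.1; positivity, by have := s.2.2; linarith⟩,
    ofBits fun i => u i && decide ((s : ℝ) / 3 < 1 / 3 ^ (i + 1)))

theorem continuous_climb (u : ℕ → Bool) :
    Continuous fun s => Quot.mk WormholeStep (climb u s) := by
  rw [continuous_iff_continuousAt]
  intro s₀
  let β : unitInterval → ℕ → Bool := fun s i => u i && decide ((s : ℝ) / 3 < 1 / 3 ^ (i + 1))
  let H : unitInterval → Icc (0 : ℝ) 1 := fun s => (climb u s).1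
  have hH : Continuous H := by
    apply Continuous.subtype_mk
    fun_prop
  have hβ : ∀ i, (s₀ : ℝ) / 3 ≠ 1 / 3 ^ (i + 1) → ∀ᶠ s in 𝓝 s₀, β s i = β s₀ i := by
    intro i hi
    have hc : Continuous fun s : unitInterval => (s : ℝ) / 3 := by fun_prop
    rcases lt_or_gt_of_ne hi with h | h
    · filter_upwards [hc.continuousAt.eventually_lt continuousAt_const h] with s hs
      simp only [β, hs, h]
    · filter_upwards [continuousAt_const.eventually_lt hc.continuousAt h] with s hs
      simp only [β, not_lt.2 hs.le, not_lt.2 h.le]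
  have hcont : ∀ b : unitInterval → ℕ → Bool, (∀ i, ∀ᶠ s in 𝓝 s₀, b s i = b s₀ i) →
      Tendsto (fun s => Quot.mk WormholeStep (H s, ofBits (b s))) (𝓝 s₀)
        (𝓝 (Quot.mk WormholeStep (H s₀, ofBits (b s₀)))) := by
    intro b hb
    refine (continuous_quot_mk.tendsto _).comp (hH.continuousAt.prodMk_nhds ?_)
    refine (cantorSetHomeomorphNatToBool.symm.continuous.tendsto _).comp ?_
    rw [tendsto_pi_nhds]
    intro i
    exact tendsto_const_nhds.congr' ((hb i).mono fun s hs => hs.symm)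
  by_cases hex : ∃ k : ℕ, (s₀ : ℝ) / 3 = 1 / 3 ^ (k + 1)
  · obtain ⟨k, hk⟩ := hex
    have hne : ∀ i, i ≠ k → (s₀ : ℝ) / 3 ≠ 1 / 3 ^ (i + 1) := by
      intro i hi h
      rw [hk] at h
      have := (pow_right_injective₀ (by norm_num : (0 : ℝ) < 3) (by norm_num))
        (inv_injective (by simpa using h) : (3 : ℝ) ^ (k + 1) = 3 ^ (i + 1))
      simp at this
      exact hi this.symm
    have hupd : ∀ c : Bool, Tendsto
        (fun s => Quot.mk WormholeStep (H s, ofBits (Function.update (β s) k c))) (𝓝 s₀)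
        (𝓝 (Quot.mk WormholeStep (H s₀, ofBits (Function.update (β s₀) k c)))) := by
      intro c
      refine hcont _ fun i => ?_
      by_cases hi : i = k
      · subst hi; simp
      · filter_upwards [hβ i (hne i hi)] with s hs
        simp [hi, hs]
    have hft : Quot.mk WormholeStep (H s₀, ofBits (Function.update (β s₀) k false))
        = Quot.mk WormholeStep (H s₀, ofBits (Function.update (β s₀) k true)) := by
      refine Quot.sound ((wormholeStep_iff _ _).2 ⟨k, ?_, ?_, rfl, ?_⟩)
      · have : ((H s₀ : ℝ)) = 1 / 3 ^ (k + 1) := hk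
        rw [this]
        exact pow_mem_wormholeHeights k
      · simp [bits_ofBits]
      · simp [bits_ofBits]
    have hself : ∀ s, Quot.mk WormholeStep (climb u s)
        = Quot.mk WormholeStep (H s, ofBits (Function.update (β s) k (β s k))) := by
      intro s
      rw [Function.update_eq_self]
      rfl
    have hall : ∀ c, Quot.mk WormholeStep (H s₀, ofBits (Function.update (β s₀) k c))
        = Quot.mk WormholeStep (climb u s₀) := by
      intro c
      rw [hself]
      cases c <;> cases β s₀ k <;> first | rfl | exact hft | exact hft.symm
    intro V hV
    have h0 := (hall false ▸ hupd false) hV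
    have h1 := (hall true ▸ hupd true) hV
    rw [mem_map] at h0 h1 ⊢
    filter_upwards [h0, h1] with s hs0 hs1
    rw [mem_preimage, hself]
    cases β s k
    · exact hs0
    · exact hs1
  · push Not at hex
    exact hcont β fun i => hβ i (hex i)

theorem hausdorffLength_climb_ne_top (u : ℕ → Bool) : hausdorffLength (range (climb u)) ≠ ⊤ := by
  have hsub : range (climb u) ⊆ {z | z.2 = ofBits u ∧ (z.1 : ℝ) ∈ ({0} : Set ℝ)} ∪
      ⋃ k : ℕ, {z | z.2 = (ofBits fun i => u i && decide (i < k)) ∧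
        (z.1 : ℝ) ∈ Icc (0 : ℝ) ((1 / 3) ^ k)} := by
    rintro _ ⟨s, rfl⟩
    rcases s.2.1.eq_or_lt with h | h
    · left
      refine ⟨?_, ?_⟩
      · simp [climb, ← h]
      · simp [climb, ← h]
    · right
      have hpos : (0 : ℝ) < s / 3 := by positivity
      have hex : ∃ k : ℕ, (1 : ℝ) / 3 ^ (k + 1) ≤ s / 3 := by
        obtain ⟨k, hk⟩ := exists_pow_lt_of_lt_one hpos (by norm_num : (1 / 3 : ℝ) < 1)
        refine ⟨k, le_trans ?_ hk.le⟩
        rw [one_div_pow]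
        exact one_div_le_one_div_of_le (by positivity) (pow_le_pow_right₀ (by norm_num) (by omega))
      classical
      refine mem_iUnion.2 ⟨Nat.find hex, ?_, hpos.le, ?_⟩
      · simp only [climb]
        congr 1
        ext i
        congr 1
        rw [decide_eq_decide]
        constructor
        · intro hi
          by_contra hc
          have h1 := Nat.find_spec hex
          have : (1 : ℝ) / 3 ^ (i + 1) ≤ 1 / 3 ^ (Nat.find hex + 1) :=
            one_div_le_one_div_of_le (by positivity)
              (pow_le_pow_right₀ (by norm_num) (by omega))
          linarith
        · intro hi
          exact not_le.1 (Nat.find_min hex hi)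
      · simp only [climb]
        rcases Nat.eq_zero_or_pos (Nat.find hex) with h0 | h0
        · rw [h0]
          have := s.2.2
          norm_num
          linarith
        · have := not_le.1 (Nat.find_min hex (m := Nat.find hex - 1) (by omega))
          rw [Nat.sub_add_cancel h0] at this
          rw [one_div_pow]
          exact this.le
  refine ne_top_of_le_ne_top ?_ (measure_mono (image_mono hsub))
  rw [image_union, image_iUnion]
  refine ne_top_of_le_ne_top ?_ ((measure_union_le _ _).trans
    (add_le_add (hausdorffLength_vertical_le _ _) ((measure_iUnion_le _).trans
      (ENNReal.tsum_le_tsum fun k => hausdorffLength_vertical_le _ _))))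
  have : Summable fun k : ℕ => ((1 / 3 : ℝ)) ^ k :=
    summable_geometric_of_lt_one (by norm_num) (by norm_num)
  simpa using this.tsum_ofReal_ne_top

theorem pathEDist_ne_top (x y : WormholeQuotient) : pathEDist x y ≠ ⊤ := by
  let o : WormholeQuotient := Quot.mk _ (climb (fun _ => false) 1)
  have key : ∀ z, pathEDist o z ≠ ⊤ := by
    intro z
    obtain ⟨⟨t, u⟩, rfl⟩ := Quot.exists_rep z
    have h1 := pathEDist_ne_top_of_curve _ (continuous_climb (bits u))
      (hausdorffLength_climb_ne_top (bits u))
    have h2 : climb (bits u) 1 = climb (fun _ => false) 1 := by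
      simp only [climb, Prod.mk.injEq, true_and]
      congr 1
      ext i
      have : ¬ ((1 : unitInterval) : ℝ) / 3 < 1 / 3 ^ (i + 1) := by
        rw [not_lt, Icc.coe_one]
        exact one_div_le_one_div_of_le (by positivity) (le_self_pow₀ (by norm_num) (by omega))
      simp only [this, decide_false, Bool.and_false]
    have h3 : climb (bits u) 0 = (0, u) := by
      simp [climb, ofBits_bits]
    rw [h2, h3] at h1
    have h4 := pathEDist_comm_le o (Quot.mk _ (0, u))
    exact ne_top_of_le_ne_top (ENNReal.add_ne_top.2 ⟨ne_top_of_le_ne_top h1 h4,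
      pathEDist_line_ne_top t u⟩) (pathEDist_triangle _ _ _)
  exact ne_top_of_le_ne_top (ENNReal.add_ne_top.2
    ⟨ne_top_of_le_ne_top (key x) (pathEDist_comm_le x o), key y⟩) (pathEDist_triangle _ _ _)

/-! ### Laakso space -/

/-- Laakso space `F = (I × K) / ∼`, with the path distance `d`. -/
def LaaksoSpace : Type := WormholeQuotient

instance : EMetricSpace LaaksoSpace where
  edist := pathEDist
  edist_self := pathEDist_self
  edist_comm x y := le_antisymm (pathEDist_comm_le x y) (pathEDist_comm_le y x)
  edist_triangle := pathEDist_triangle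
  eq_of_edist_eq_zero := eq_of_pathEDist_eq_zero

instance : MetricSpace LaaksoSpace := EMetricSpace.toMetricSpace pathEDist_ne_top

instance : MeasurableSpace LaaksoSpace := borel LaaksoSpace

instance : BorelSpace LaaksoSpace := ⟨rfl⟩

/-- The projection `q : I × K → F`, `q (x₁, x₂) = [x₁, x₂]`. -/
def proj : IK → LaaksoSpace := Quot.mk WormholeStep

/-- The height `h : F → I`, `h [x₁, x₂] = x₁`. -/
def height : LaaksoSpace → ℝ := quotHeight

/-! ### Directional derivatives and differentiability -/

/-- `(f [x₁ + t, x₂] - f [x₁, x₂]) / t → L` as `t → 0`, `t ≠ 0`, `x₁ + t ∈ I`, written with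
`s = x₁ + t`. -/
def HasLineDeriv (f : LaaksoSpace → ℝ) (p : IK) (L : ℝ) : Prop :=
  Tendsto (fun s : Icc (0 : ℝ) 1 => (f (proj (s, p.2)) - f (proj p)) / ((s : ℝ) - (p.1 : ℝ)))
    (𝓝[≠] p.1) (𝓝 L)

/-- The directional derivative `f_I(x)` exists and equals `L`. A point that is not a wormhole has
one representative in `I × K`; a wormhole has two, and then both derivatives have to exist and to
be equal to `L`. -/
def HasDirectionalDeriv (f : LaaksoSpace → ℝ) (x : LaaksoSpace) (L : ℝ) : Prop :=
  ∀ p : IK, proj p = x → HasLineDeriv f p L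

/-- `f` is differentiable at `x`, with respect to the height. -/
def IsDifferentiableAt (f : LaaksoSpace → ℝ) (x : LaaksoSpace) : Prop :=
  ∃ D : ℝ, Tendsto (fun y => (f y - f x - D * (height y - height x)) / dist y x) (𝓝[≠] x) (𝓝 0)

/-- `f` is Lipschitz with respect to `d`. -/
def IsLipschitz (f : LaaksoSpace → ℝ) : Prop := ∃ C : ℝ≥0, LipschitzWith C f

/-- The Lipschitz constant `Lip(f)` of a Lipschitz function: its smallest Lipschitz constant. -/
def lipConst (f : LaaksoSpace → ℝ) : ℝ≥0 := sInf {C : ℝ≥0 | LipschitzWith C f}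

/-- `f` has a maximal directional derivative at `x`: `f_I(x)` exists and `|f_I(x)| = Lip(f)`. -/
def HasMaximalDirectionalDeriv (f : LaaksoSpace → ℝ) (x : LaaksoSpace) : Prop :=
  ∃ L : ℝ, HasDirectionalDeriv f x L ∧ |L| = lipConst f

/-- The set `M` of the points at which maximality of a directional derivative implies
differentiability, for every Lipschitz function. -/
def maximalityImpliesDiff : Set LaaksoSpace :=
  {x | ∀ f : LaaksoSpace → ℝ, IsLipschitz f → HasMaximalDirectionalDeriv f x →
    IsDifferentiableAt f x}

/-! ### The set `S` -/

/-- `D_n⁺(t) = inf {s > 0 : t + s ∈ J_n}`, in `[0, ∞]`, with `inf ∅ = ∞`. -/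
def distAbove (n : ℕ) (t : ℝ) : ℝ≥0∞ :=
  ⨅ (s : ℝ) (_ : 0 < s ∧ t + s ∈ wormholeHeights n), ENNReal.ofReal s

/-- `D_n⁻(t) = inf {s > 0 : t - s ∈ J_n}`, in `[0, ∞]`, with `inf ∅ = ∞`. -/
def distBelow (n : ℕ) (t : ℝ) : ℝ≥0∞ :=
  ⨅ (s : ℝ) (_ : 0 < s ∧ t - s ∈ wormholeHeights n), ENNReal.ofReal s

/-- The set `S ⊆ (0, 1)` of the heights `t` for which `D_n⁺(t) / D_n⁻(t)` stays between `1 / C` and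
`C` for all large `n`, with some `C = C(t) ≥ 1`. -/
def comparableHeights : Set ℝ :=
  {t | t ∈ Ioo (0 : ℝ) 1 ∧ ∃ C : ℝ≥0, 1 ≤ C ∧ ∃ N : ℕ, ∀ n : ℕ, N ≤ n →
    (C : ℝ≥0∞)⁻¹ ≤ distAbove n t / distBelow n t ∧ distAbove n t / distBelow n t ≤ C}

/-! ### Porous sets -/

/-- A set `P` is porous if there is `0 < ρ < 1` such that for all `x ∈ P` and `δ > 0` there is a
point `y ≠ x` with `d(y, x) < δ` and `B(y, ρ d(y, x)) ∩ P = ∅`. -/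
def IsPorous {X : Type*} [MetricSpace X] (P : Set X) : Prop :=
  ∃ ρ : ℝ, 0 < ρ ∧ ρ < 1 ∧ ∀ x ∈ P, ∀ δ : ℝ, 0 < δ →
    ∃ y : X, y ≠ x ∧ dist y x < δ ∧ Metric.ball y (ρ * dist y x) ∩ P = ∅

/-- A set is `σ`-porous if it is a countable union of porous sets. -/
def IsSigmaPorous {X : Type*} [MetricSpace X] (A : Set X) : Prop :=
  ∃ P : ℕ → Set X, (∀ n, IsPorous (P n)) ∧ A = ⋃ n, P n

end Laakso

end

/-!
Write `x = [t, u]`, `J n` for the wormhole heights of order `n`, and `d` for the distance. Everything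
rests on two facts about `d`. If two points differ in the digit of index `k`, a path between them
has to meet a height in `J (k + 1)` (`exists_wormholeHeight_near`); and if every digit in which they
differ can be changed at a height between theirs, then their distance is the difference of their
heights (`dist_proj_le_of_le`).

The set `S` consists of the `t` in `(0, 1)` such that, for some `j`, the points of `J n` other than
`t` are at distance at least `3 ^ (-n) / (j + 1)` from `t`, for all `n ≥ j`
(`comparableHeights_eq_iUnion`).

If `t` is such a height and `y` is close to `x`, then the digits in which `y` differs from a suitable
representative of `x` have orders `n` with `3 ^ (-n) ≤ (j + 1) d(x, y)`. So there are points `z` on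
the line through `x`, one above and one below, at distance `(2 j + 3) d(x, y)` from `x`, which are
joined to `y` by paths of monotone height. A Lipschitz function with maximal directional derivative
at `x` is almost affine with extremal slope on the line, and the Lipschitz condition between `y` and
the two points `z` leaves no freedom for its value at `y`
(`isDifferentiableAt_of_mem_separatedHeights`).

If `t` is in `(0, 1)` but not in `S`, there are orders `n` for which `J n` comes within `a` of `t`
on one side but not within `b` on the other, with `a / b` arbitrarily small; at the ends of the
lines there are no wormholes at all on one side. Changing the digit of order `n` of `x` gives a
point `y` at distance `2 a` from `x` and of the same height. A function of maximal slope may have a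
value `-a` at `y`: the cone of slope `1` with that vertex lies above the affine function on the
line through `x`, on one side because the path from the vertex leads through the height at distance
`a`, and on the other up to an error `a` that is small compared to `b`. The minimum of the
affine function and of infinitely many such cones has a maximal directional derivative at `x`, but
is not differentiable there (`proj_notMem_of_gaps`).

Porosity and measure only use the heights: directly above a point of `J n` there is an interval of
length `3 ^ (-n) / (j + 1)` that avoids `separatedHeights j` (`isPorous_image_separatedHeights`), so
the proportion of triadic intervals of order `n` that meet this set tends to `0` along a sequence of
`n`. The `6 ^ n` cells of order `n` of Laakso space have diameter at most `3 / 3 ^ n`, and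
`(3 / 3 ^ n) ^ Q = 6 / 6 ^ n` (`hausdorffMeasure_image_separatedHeights`).
-/

namespace Laakso

/-! ### Wormhole heights as triadic rationals -/

theorem exists_ternary_digits (n : ℕ) (k : ℕ) (hk : k < 3 ^ n) :
    ∃ m : Fin n → Fin 3, (k : ℝ) / 3 ^ n = ∑ i : Fin n, ((m i).val : ℝ) / 3 ^ (i.val + 1) ∧
      ∀ i : Fin n, i.val + 1 = n → (m i).val = k % 3 := by
  induction n generalizing k with
  | zero =>
    obtain rfl : k = 0 := by simpa using hk
    exact ⟨fun _ => 0, by simp, fun i => i.elim0⟩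
  | succ n ih =>
    obtain ⟨m, hm, -⟩ := ih (k / 3) (by rw [pow_succ] at hk; omega)
    refine ⟨Fin.snoc m ⟨k % 3, Nat.mod_lt _ (by norm_num)⟩, ?_, ?_⟩
    · rw [Fin.sum_univ_castSucc]
      simp only [Fin.snoc_castSucc, Fin.snoc_last, Fin.val_castSucc, Fin.val_last]
      rw [← hm]
      have : (k : ℝ) = 3 * (k / 3 : ℕ) + (k % 3 : ℕ) := by
        exact_mod_cast (Nat.div_add_mod k 3).symm
      rw [this, pow_succ]
      field_simp
    · intro i hi
      have : i = Fin.last n := Fin.ext (by simpa using hi)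
      subst this
      simp

/-- `J_{n+1}` consists of the fractions `k / 3 ^ (n + 1)` in lowest terms in `(0, 1)`. -/
theorem mem_wormholeHeights_iff {n : ℕ} {t : ℝ} : t ∈ wormholeHeights (n + 1) ↔
    ∃ k : ℕ, ¬ 3 ∣ k ∧ k < 3 ^ (n + 1) ∧ t = k / 3 ^ (n + 1) := by
  constructor
  · intro ht
    obtain ⟨k, hk, h3⟩ := wormholeHeights_int ht
    refine ⟨k, h3, ?_, by rw [← hk]; field_simp⟩
    have hlt : t < 1 := by
      obtain ⟨m, -, rfl⟩ := ht
      have hgeom : ∀ j : ℕ, ∑ i : Fin j, (2 : ℝ) / 3 ^ (i.val + 1) = 1 - 1 / 3 ^ j := by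
        intro j
        induction j with
        | zero => simp
        | succ j ih =>
          rw [Fin.sum_univ_castSucc]
          simp only [Fin.val_castSucc, Fin.val_last]
          rw [ih, pow_succ]
          field_simp
          ring
      have hle : ∑ i : Fin (n + 1), ((m i).val : ℝ) / 3 ^ (i.val + 1) ≤
          ∑ i : Fin (n + 1), (2 : ℝ) / 3 ^ (i.val + 1) := by
        refine Finset.sum_le_sum fun i _ => ?_
        have : ((m i).val : ℝ) ≤ 2 := by exact_mod_cast (by omega : (m i).val ≤ 2)
        gcongr
      rw [hgeom] at hle
      have : (0 : ℝ) < 1 / 3 ^ (n + 1) := by positivity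
      linarith
    have : (k : ℝ) < (3 : ℝ) ^ (n + 1) := by
      rw [← hk]
      exact mul_lt_of_lt_one_left (by positivity) hlt
    exact_mod_cast this
  · rintro ⟨k, h3, hk, rfl⟩
    obtain ⟨m, hm, hl⟩ := exists_ternary_digits (n + 1) k hk
    refine ⟨m, ⟨Fin.last n, by simp, ?_⟩, hm⟩
    have := hl (Fin.last n) (by simp)
    rw [Fin.lt_def, this]
    simp only [Fin.val_zero]
    omega

theorem wormholeHeights_zero : wormholeHeights 0 = ∅ := by
  ext t
  constructor
  · rintro ⟨-, ⟨i, -⟩, -⟩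
    exact i.elim0
  · exact False.elim

theorem wormholeHeights_subset_Ioo (n : ℕ) : wormholeHeights n ⊆ Ioo 0 1 := by
  cases n with
  | zero => simp [wormholeHeights_zero]
  | succ n =>
    intro t ht
    obtain ⟨k, h3, hk, rfl⟩ := mem_wormholeHeights_iff.1 ht
    have h0 : 0 < k := by
      rcases Nat.eq_zero_or_pos k with rfl | h
      · simp at h3
      · exact h
    constructor
    · positivity
    · rw [div_lt_one (by positivity)]
      exact_mod_cast hk

theorem add_inv_pow_le_of_lt {n : ℕ} {s t : ℝ} (hs : s ∈ wormholeHeights n)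
    (ht : t ∈ wormholeHeights n) (hst : s < t) : s + 1 / 3 ^ n ≤ t := by
  cases n with
  | zero => simp [wormholeHeights_zero] at hs
  | succ n =>
    obtain ⟨k, -, -, rfl⟩ := mem_wormholeHeights_iff.1 hs
    obtain ⟨l, -, -, rfl⟩ := mem_wormholeHeights_iff.1 ht
    rw [div_lt_div_iff_of_pos_right (by positivity)] at hst
    rw [← add_div]
    have : k + 1 ≤ l := by exact_mod_cast hst
    gcongr
    exact_mod_cast this

/-- Of two consecutive multiples of `3 ^ (-n)` in `[0, 1]` at least one is in `J_n`. -/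
theorem exists_mem_wormholeHeights {n : ℕ} (hn : n ≠ 0) {a b : ℝ} (ha : 0 ≤ a) (hb : b ≤ 1)
    (hab : 2 / 3 ^ n ≤ b - a) : ∃ t ∈ wormholeHeights n, a ≤ t ∧ t ≤ b := by
  obtain ⟨n, rfl⟩ := Nat.exists_eq_succ_of_ne_zero hn
  have hp : (0 : ℝ) < 3 ^ (n + 1) := by positivity
  set j := ⌈a * 3 ^ (n + 1)⌉₊ with hj
  have h1 : a * 3 ^ (n + 1) ≤ j := Nat.le_ceil _
  have h2 : (j : ℝ) < a * 3 ^ (n + 1) + 1 := Nat.ceil_lt_add_one (by positivity)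
  have h3 : a * 3 ^ (n + 1) + 2 ≤ b * 3 ^ (n + 1) := by
    rw [div_le_iff₀ hp] at hab
    linarith
  have key : ∀ k : ℕ, ¬ 3 ∣ k → a * 3 ^ (n + 1) ≤ k → (k : ℝ) ≤ b * 3 ^ (n + 1) →
      ∃ t ∈ wormholeHeights (n + 1), a ≤ t ∧ t ≤ b := by
    intro k hk hak hkb
    refine ⟨k / 3 ^ (n + 1), mem_wormholeHeights_iff.2 ⟨k, hk, ?_, rfl⟩, ?_, ?_⟩
    · have h4 : (k : ℝ) ≤ 3 ^ (n + 1) := hkb.trans (mul_le_of_le_one_left hp.le hb)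
      have h5 : k ≤ 3 ^ (n + 1) := by exact_mod_cast h4
      refine lt_of_le_of_ne h5 ?_
      rintro rfl
      exact hk (dvd_pow_self 3 (by omega))
    · rwa [le_div_iff₀ hp]
    · rwa [div_le_iff₀ hp]
  by_cases hd : 3 ∣ j
  · refine key (j + 1) (by omega) (by push_cast; linarith) (by push_cast; linarith)
  · exact key j hd h1 (by linarith)

/-! ### Lower bounds for the distance -/

theorem height_proj (p : IK) : height (proj p) = p.1 := rfl

theorem edist_proj (p r : IK) :
    edist (proj p) (proj r) = pathEDist (Quot.mk WormholeStep p) (Quot.mk WormholeStep r) := rfl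

/-- A distance is realised up to an arbitrarily small error by a path whose length bounds the
oscillation of the height. -/
theorem exists_path_of_dist_lt {p r : IK} {c : ℝ} (h : dist (proj p) (proj r) < c) :
    ∃ γ : Path (Quot.mk WormholeStep p) (Quot.mk WormholeStep r),
      ∀ s t, |quotHeight (γ s) - quotHeight (γ t)| ≤ c := by
  have h1 : pathEDist (Quot.mk WormholeStep p) (Quot.mk WormholeStep r) < ENNReal.ofReal c := by
    rw [← edist_proj, edist_dist]
    exact (ENNReal.ofReal_lt_ofReal_iff (dist_nonneg.trans_lt h)).2 h
  simp only [pathEDist, iInf_lt_iff] at h1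
  obtain ⟨A, ⟨γ, hγ⟩, hA⟩ := h1
  refine ⟨γ, fun s t => ?_⟩
  exact (ENNReal.ofReal_le_ofReal_iff (dist_nonneg.trans h.le)).1
    ((le_hausdorffLength γ hγ s t).trans hA.le)

theorem abs_sub_le_dist_proj (p r : IK) : |(p.1 : ℝ) - r.1| ≤ dist (proj p) (proj r) := by
  refine le_of_forall_gt_imp_ge_of_dense fun c hc => ?_
  obtain ⟨γ, hγ⟩ := exists_path_of_dist_lt hc
  simpa [quotHeight_mk] using hγ 0 1

/-- The digit of index `k` is locally constant off the wormhole level of order `k + 1`, so a path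
joining points with different such digits meets that level. -/
theorem exists_height_mem_wormholeHeights {p r : IK}
    (γ : Path (Quot.mk WormholeStep p) (Quot.mk WormholeStep r)) {k : ℕ}
    (hk : bits p.2 k ≠ bits r.2 k) : ∃ s, quotHeight (γ s) ∈ wormholeHeights (k + 1) := by
  by_contra! hγ
  let U : Bool → Set WormholeQuotient := fun b => {w | Quot.lift
    (fun p : IK => (p.1 : ℝ) ∉ wormholeHeights (k + 1) ∧ bits p.2 k = b) (by
      intro p r hpr
      obtain ⟨j, hj, hb, h1, h2⟩ := (wormholeStep_iff p r).1 hpr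
      rw [h1]
      refine propext (and_congr_right fun hp => ?_)
      have : k ≠ j := by
        rintro rfl
        exact hp hj
      rw [h2, Function.update_of_ne this]) w}
  have hU : ∀ b, IsOpen (U b) := by
    intro b
    rw [← isQuotientMap_quot_mk.isOpen_preimage]
    have h1 : Continuous fun p : IK => bits p.2 k :=
      (continuous_apply k).comp (cantorSetHomeomorphNatToBool.continuous.comp continuous_snd)
    have h2 : Continuous fun p : IK => (p.1 : ℝ) := by fun_prop
    exact ((wormholeHeights_finite (k + 1)).isClosed.isOpen_compl.preimage h2).inter
      ((isOpen_discrete {b}).preimage h1)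
  have hcov : range γ ⊆ U (bits p.2 k) ∪ U (bits r.2 k) := by
    rintro _ ⟨s, rfl⟩
    have hs := hγ s
    obtain ⟨z, hz⟩ := Quot.exists_rep (γ s)
    rw [← hz] at hs ⊢
    by_cases hzp : bits z.2 k = bits p.2 k
    · exact Or.inl ⟨hs, hzp⟩
    · refine Or.inr ⟨hs, ?_⟩
      cases h1 : bits z.2 k <;> cases h2 : bits p.2 k <;> cases h3 : bits r.2 k <;> simp_all
  have hpre : IsPreconnected (range γ) := isPreconnected_range γ.continuous
  have h0 := hγ 0
  have h1 := hγ 1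
  rw [γ.source] at h0
  rw [γ.target] at h1
  obtain ⟨w, -, hwu, hwv⟩ := hpre _ _ (hU (bits p.2 k)) (hU (bits r.2 k)) hcov
    ⟨_, ⟨0, γ.source⟩, h0, rfl⟩ ⟨_, ⟨1, γ.target⟩, h1, rfl⟩
  obtain ⟨z, rfl⟩ := Quot.exists_rep w
  exact hk (hwu.2.symm.trans hwv.2)

theorem exists_wormholeHeight_near {p r : IK} {k : ℕ} (hk : bits p.2 k ≠ bits r.2 k) :
    ∃ t ∈ wormholeHeights (k + 1), |t - p.1| ≤ dist (proj p) (proj r) ∧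
      |t - r.1| ≤ dist (proj p) (proj r) := by
  have key : ∀ c, dist (proj p) (proj r) < c → ∃ t ∈ wormholeHeights (k + 1),
      max |t - p.1| |t - r.1| ≤ c := by
    intro c hc
    obtain ⟨γ, hγ⟩ := exists_path_of_dist_lt hc
    obtain ⟨s, hs⟩ := exists_height_mem_wormholeHeights γ hk
    refine ⟨_, hs, max_le ?_ ?_⟩
    · simpa [quotHeight_mk] using hγ s 0
    · simpa [quotHeight_mk] using hγ s 1
  have hne : (wormholeHeights (k + 1)).Nonempty := ⟨_, pow_mem_wormholeHeights k⟩
  -- the optimal crossing height, among finitely many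
  obtain ⟨t, ht, hmin⟩ := exists_min_image _ (fun t : ℝ => max |t - p.1| |t - r.1|)
    (wormholeHeights_finite (k + 1)) hne
  refine ⟨t, ht, ?_⟩
  rw [← max_le_iff]
  refine le_of_forall_gt_imp_ge_of_dense fun c hc => ?_
  obtain ⟨t', ht', h⟩ := key c hc
  exact (hmin t' ht').trans h

/-! ### Monotone paths -/

theorem proj_update {t : Icc (0 : ℝ) 1} {k : ℕ} (ht : (t : ℝ) ∈ wormholeHeights (k + 1))
    (b : ℕ → Bool) (c : Bool) : proj (t, ofBits (Function.update b k c)) = proj (t, ofBits b) := by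
  have hft : proj (t, ofBits (Function.update b k false))
      = proj (t, ofBits (Function.update b k true)) := by
    refine Quot.sound ((wormholeStep_iff _ _).2 ⟨k, ht, ?_, rfl, ?_⟩)
    · simp [bits_ofBits]
    · simp [bits_ofBits]
  have hself : proj (t, ofBits b) = proj (t, ofBits (Function.update b k (b k))) := by
    rw [Function.update_eq_self]
  rw [hself]
  cases c <;> cases b k <;> first | rfl | exact hft | exact hft.symm

theorem continuous_quotMk_of_bits {H : unitInterval → Icc (0 : ℝ) 1} (hH : Continuous H)
    {β : unitInterval → ℕ → Bool}
    (hβ : ∀ s₀ i, (H s₀ : ℝ) ∉ wormholeHeights (i + 1) → ∀ᶠ s in 𝓝 s₀, β s i = β s₀ i) :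
    Continuous fun s => Quot.mk WormholeStep (H s, ofBits (β s)) := by
  rw [continuous_iff_continuousAt]
  intro s₀
  have hcont : ∀ b : unitInterval → ℕ → Bool, (∀ i, ∀ᶠ s in 𝓝 s₀, b s i = b s₀ i) →
      Tendsto (fun s => Quot.mk WormholeStep (H s, ofBits (b s))) (𝓝 s₀)
        (𝓝 (Quot.mk WormholeStep (H s₀, ofBits (b s₀)))) := by
    intro b hb
    refine (continuous_quot_mk.tendsto _).comp (hH.continuousAt.prodMk_nhds ?_)
    refine (cantorSetHomeomorphNatToBool.symm.continuous.tendsto _).comp ?_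
    rw [tendsto_pi_nhds]
    intro i
    exact tendsto_const_nhds.congr' ((hb i).mono fun s hs => hs.symm)
  by_cases hex : ∃ k : ℕ, (H s₀ : ℝ) ∈ wormholeHeights (k + 1)
  · obtain ⟨k, hk⟩ := hex
    have hupd : ∀ c : Bool, Tendsto
        (fun s => Quot.mk WormholeStep (H s, ofBits (Function.update (β s) k c))) (𝓝 s₀)
        (𝓝 (Quot.mk WormholeStep (H s₀, ofBits (β s₀)))) := by
      intro c
      have h2 : Quot.mk WormholeStep (H s₀, ofBits (Function.update (β s₀) k c)) =
        Quot.mk WormholeStep (H s₀, ofBits (β s₀)) := proj_update hk (β s₀) c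
      rw [← h2]
      refine hcont _ fun i => ?_
      by_cases hi : i = k
      · subst hi; simp
      · filter_upwards [hβ s₀ i fun h => hi (wormholeHeights_disjoint h hk)] with s hs
        simp [hi, hs]
    intro V hV
    have h0 := hupd false hV
    have h1 := hupd true hV
    rw [mem_map] at h0 h1 ⊢
    filter_upwards [h0, h1] with s hs0 hs1
    rw [mem_preimage, ← Function.update_eq_self k (β s)]
    cases β s k
    · exact hs0
    · exact hs1
  · push Not at hex
    exact hcont β fun i => hβ s₀ i (hex i)

/-- A curve that rises from height `a` to height `b` and visits countably many lines has length at
most `b - a`. -/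
theorem hausdorffLength_le_of_countable {a b : ℝ} {g : ℝ → cantorSet}
    (hg : ∀ c, MeasurableSet {s ∈ Icc a b | g s = c}) (hc : (g '' Icc a b).Countable) :
    hausdorffLength {z | (z.1 : ℝ) ∈ Icc a b ∧ z.2 = g z.1} ≤ ENNReal.ofReal (b - a) := by
  have hsub : {z : IK | (z.1 : ℝ) ∈ Icc a b ∧ z.2 = g z.1} ⊆
      ⋃ c ∈ g '' Icc a b, {z | z.2 = c ∧ (z.1 : ℝ) ∈ {s ∈ Icc a b | g s = c}} := by
    rintro z ⟨hz, hzg⟩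
    simp only [mem_iUnion]
    exact ⟨g z.1, mem_image_of_mem g hz, hzg, hz, rfl⟩
  have hle : ∀ c : cantorSet, hausdorffLength {z | z.2 = c ∧ (z.1 : ℝ) ∈ {s ∈ Icc a b | g s = c}}
      ≤ volume {s ∈ Icc a b | g s = c} := fun c => hausdorffLength_vertical_le c _
  calc hausdorffLength {z | (z.1 : ℝ) ∈ Icc a b ∧ z.2 = g z.1}
      ≤ ∑' c : g '' Icc a b, hausdorffLength
          {z | z.2 = (c : cantorSet) ∧ (z.1 : ℝ) ∈ {s ∈ Icc a b | g s = c}} := by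
        refine (measure_mono (image_mono hsub)).trans ?_
        simp only [image_iUnion]
        exact measure_biUnion_le _ hc _
    _ ≤ ∑' c : g '' Icc a b, volume {s ∈ Icc a b | g s = c} :=
        ENNReal.tsum_le_tsum fun c => hle c
    _ = volume (⋃ c ∈ g '' Icc a b, {s ∈ Icc a b | g s = c}) := by
        rw [measure_biUnion hc _ fun c _ => hg c]
        intro c _ c' _ hne
        refine Set.disjoint_left.2 ?_
        rintro s ⟨-, h1⟩ ⟨-, h2⟩
        exact hne (h1.symm.trans h2)
    _ ≤ volume (Icc a b) := measure_mono (iUnion₂_subset fun c _ s hs => hs.1)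
    _ = ENNReal.ofReal (b - a) := Real.volume_Icc

theorem edist_proj_le_of_curve (g : unitInterval → IK)
    (hc : Continuous fun s => Quot.mk WormholeStep (g s)) :
    edist (proj (g 0)) (proj (g 1)) ≤ hausdorffLength (range g) := by
  rw [edist_proj]
  refine iInf₂_le (range g) ⟨⟨⟨_, hc⟩, rfl, rfl⟩, ?_⟩
  rw [← range_comp]
  rfl

/-- A curve `r ↦ [r, B r]`, `s ≤ r ≤ t`, whose digits change only at wormhole levels of the
corresponding order and which visits countably many lines, has length at most `t - s`. -/
theorem edist_proj_le_of_curve_of_countable {s t : Icc (0 : ℝ) 1} (hst : (s : ℝ) ≤ t)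
    {B : ℝ → ℕ → Bool}
    (hloc : ∀ (r : ℝ) (i : ℕ), r ∉ wormholeHeights (i + 1) → ∀ᶠ r' in 𝓝 r, B r' i = B r i)
    (hmeas : ∀ k, Measurable fun r => B r k)
    (hcount : ((fun r => ofBits (B r)) '' Icc (s : ℝ) t).Countable) :
    edist (proj (s, ofBits (B s))) (proj (t, ofBits (B t))) ≤ ENNReal.ofReal (t - s) := by
  set H : unitInterval → Icc (0 : ℝ) 1 := fun r =>
    ⟨s + r * (t - s), by have := r.2.1; have := s.2.1; nlinarith,
      by have := r.2.2; have := t.2.2; nlinarith⟩ with hHdef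
  have hH : Continuous H := by
    apply Continuous.subtype_mk
    fun_prop
  have hH : Continuous H := by
    apply Continuous.subtype_mk
    fun_prop
  have hcont : Continuous fun r => Quot.mk WormholeStep (H r, ofBits (B (H r))) :=
    continuous_quotMk_of_bits (β := fun r => B (H r)) hH fun r i hi =>
      (continuous_subtype_val.comp hH).continuousAt.eventually (hloc (H r) i hi)
  have hHI : ∀ r, (H r : ℝ) ∈ Icc (s : ℝ) t := by
    intro r
    have h1 := r.2.1
    have h2 := r.2.2
    constructor <;> simp only [hHdef] <;> nlinarith
  have h0 : H 0 = s := Subtype.ext (by simp [H])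
  have h1 : H 1 = t := Subtype.ext (by simp [H])
  clear_value H
  have hset : ∀ c, MeasurableSet {r ∈ Icc (s : ℝ) t | ofBits (B r) = c} := by
    intro c
    have : {r ∈ Icc (s : ℝ) t | ofBits (B r) = c} =
        Icc (s : ℝ) t ∩ ⋂ k, {r | B r k = bits c k} := by
      ext r
      simp only [mem_ofPred_eq, mem_inter_iff, mem_iInter]
      refine and_congr_right fun _ => ?_
      rw [← funext_iff]
      constructor
      · rintro rfl
        rw [bits_ofBits]
      · intro h
        rw [h, ofBits_bits]
    rw [this]
    exact measurableSet_Icc.inter (MeasurableSet.iInter fun k =>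
      hmeas k (measurableSet_singleton (bits c k)))
  have hle := edist_proj_le_of_curve _ hcont
  rw [h0, h1] at hle
  have hsub : range (fun r => (H r, ofBits (B (H r)))) ⊆
      {z : IK | (z.1 : ℝ) ∈ Icc (s : ℝ) t ∧ z.2 = ofBits (B z.1)} := by
    rintro _ ⟨r, rfl⟩
    exact ⟨hHI r, rfl⟩
  exact hle.trans ((measure_mono (image_mono hsub)).trans
    (hausdorffLength_le_of_countable (g := fun r => ofBits (B r)) hset hcount))

/-- If every digit in which `u` and `v` differ can be changed at a height between `s` and `t`, then
`[s, u]` and `[t, v]` are joined by a path of length `t - s` along which the height is monotone. -/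
theorem dist_proj_le_of_le {s t : Icc (0 : ℝ) 1} (hst : (s : ℝ) ≤ t) {u v : cantorSet}
    (h : ∀ k, bits u k ≠ bits v k → ∃ τ ∈ wormholeHeights (k + 1), (s : ℝ) ≤ τ ∧ τ ≤ t) :
    dist (proj (s, u)) (proj (t, v)) ≤ (t : ℝ) - s := by
  -- crossing heights accumulating only at `t`, so that the path visits countably many lines
  have hτ : ∀ k, ∃ τ : ℝ, (bits u k ≠ bits v k → τ ∈ wormholeHeights (k + 1)) ∧
      (bits u k ≠ bits v k → (s : ℝ) ≤ τ ∧ τ ≤ t) ∧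
      (2 / 3 ^ (k + 1) ≤ (t : ℝ) - s → (t : ℝ) - 2 / 3 ^ (k + 1) ≤ τ) := by
    intro k
    by_cases hk : 2 / 3 ^ (k + 1) ≤ (t : ℝ) - s
    · obtain ⟨τ, h1, h2, h3⟩ := exists_mem_wormholeHeights (n := k + 1) (by omega)
        (a := t - 2 / 3 ^ (k + 1)) (b := t) (by linarith [s.2.1]) t.2.2 (by linarith)
      exact ⟨τ, fun _ => h1, fun _ => ⟨by linarith, h3⟩, fun _ => h2⟩
    · by_cases hd : bits u k ≠ bits v k
      · obtain ⟨τ, h1, h2, h3⟩ := h k hd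
        exact ⟨τ, fun _ => h1, fun _ => ⟨h2, h3⟩, fun h => absurd h hk⟩
      · exact ⟨0, fun h => absurd h hd, fun h => absurd h hd, fun h => absurd h hk⟩
  choose τ hτJ hτI hτt using hτ
  let B : ℝ → ℕ → Bool := fun r k => if r < τ k then bits u k else bits v k
  have hloc : ∀ (r : ℝ) (i : ℕ), r ∉ wormholeHeights (i + 1) → ∀ᶠ r' in 𝓝 r, B r' i = B r i := by
    intro r i hi
    by_cases hd : bits u i = bits v i
    · simp [B, hd]
    · have hne : r ≠ τ i := by
        rintro rfl
        exact hi (hτJ i hd)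
      rcases lt_or_gt_of_ne hne with h | h
      · filter_upwards [gt_mem_nhds h] with s hs
        simp only [B, hs, h]
      · filter_upwards [lt_mem_nhds h] with s hs
        simp only [B, not_lt.2 hs.le, not_lt.2 h.le]
  have hstart : proj (s, u) = proj (s, ofBits (B s)) := by
    by_cases hs : ∃ k, bits u k ≠ bits v k ∧ τ k ≤ s
    · obtain ⟨k, hk, hks⟩ := hs
      have hks' : τ k = s := le_antisymm hks (hτI k hk).1
      have hJ : (s : ℝ) ∈ wormholeHeights (k + 1) := hks' ▸ hτJ k hk
      have hb : B s = Function.update (bits u) k (bits v k) := by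
        ext i
        by_cases hi : i = k
        · subst hi
          simp [B, hks]
        · by_cases hd : bits u i = bits v i
          · simp [B, hi, hd]
          · have : (s : ℝ) < τ i := by
              refine lt_of_le_of_ne (hτI i hd).1 fun h => hi ?_
              exact wormholeHeights_disjoint (h ▸ hτJ i hd) hJ
            simp [B, hi, this]
      rw [hb, proj_update hJ, ofBits_bits]
    · push Not at hs
      have hb : B s = bits u := by
        ext i
        by_cases hd : bits u i = bits v i
        · simp [B, hd]
        · simp [B, hs i hd]
      rw [hb, ofBits_bits]
  have hend : proj (t, v) = proj (t, ofBits (B t)) := by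
    have hb : B t = bits v := by
      ext i
      by_cases hd : bits u i = bits v i
      · simp [B, hd]
      · simp [B, not_lt.2 (hτI i hd).2]
    rw [hb, ofBits_bits]
  have hcount : ((fun r => ofBits (B r)) '' Icc (s : ℝ) t).Countable := by
    -- below `t` only finitely many digits have been changed
    have hsub : (fun r => ofBits (B r)) '' Icc (s : ℝ) t ⊆ insert (ofBits (B t))
        (range fun F : Finset ℕ => ofBits fun k => if k ∈ F then bits v k else bits u k) := by
      rintro _ ⟨r, hr, rfl⟩
      rcases hr.2.eq_or_lt with h | h
      · exact Or.inl (by simp [h])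
      · right
        have hfin : {k | ¬ r < τ k}.Finite := by
          have ht0 : Tendsto (fun k : ℕ => (2 : ℝ) * (1 / 3) ^ (k + 1)) atTop (𝓝 0) := by
            have := (tendsto_pow_atTop_nhds_zero_of_lt_one (by norm_num : (0 : ℝ) ≤ 1 / 3)
              (by norm_num)).comp (tendsto_add_atTop_nat 1)
            simpa using this.const_mul 2
          have hev := ht0.eventually (gt_mem_nhds (sub_pos.2 h))
          rw [← Nat.cofinite_eq_atTop, eventually_cofinite] at hev
          refine hev.subset fun k hk hlt => hk ?_
          have he : (2 : ℝ) * (1 / 3) ^ (k + 1) = 2 / 3 ^ (k + 1) := by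
            rw [one_div_pow]; ring
          rw [he] at hlt
          have := hτt k (by linarith [hr.1])
          linarith
        refine ⟨hfin.toFinset, ?_⟩
        simp only [B]
        congr 1
        ext k
        by_cases hk : r < τ k <;> simp [hk]
    exact ((countable_range _).insert _).mono hsub
  have hmeas : ∀ k, Measurable fun r => B r k := fun k =>
    Measurable.ite measurableSet_Iio measurable_const measurable_const
  rw [hstart, hend]
  have hlen := edist_proj_le_of_curve_of_countable hst hloc hmeas hcount
  rw [edist_dist] at hlen
  exact (ENNReal.ofReal_le_ofReal_iff (by linarith)).1 hlen

theorem dist_proj_le_abs (s t : Icc (0 : ℝ) 1) (u : cantorSet) :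
    dist (proj (s, u)) (proj (t, u)) ≤ |(s : ℝ) - t| := by
  rcases le_total (s : ℝ) t with h | h
  · rw [abs_sub_comm]
    exact (dist_proj_le_of_le h fun k hk => absurd rfl hk).trans (le_abs_self _)
  · rw [dist_comm]
    exact (dist_proj_le_of_le h fun k hk => absurd rfl hk).trans (le_abs_self _)

/-! ### Comparable heights are the heights far from the wormhole levels -/

/-- The heights `t` for which every point of `J_n` other than `t`, with `n ≥ j`, is at distance at
least `3 ^ (-n) / (j + 1)` from `t`. -/
def separatedHeights (j : ℕ) : Set ℝ :=
  {t | t ∈ Ioo (0 : ℝ) 1 ∧ ∀ n, j ≤ n → ∀ τ ∈ wormholeHeights n, τ ≠ t →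
    1 / 3 ^ n ≤ (j + 1) * |τ - t|}

theorem exists_distAbove {n : ℕ} (hn : n ≠ 0) {t : ℝ} (ht : 0 ≤ t) (h : 3 / 3 ^ n ≤ 1 - t) :
    ∃ b : ℝ, 0 < b ∧ b ≤ 3 / 3 ^ n ∧ t + b ∈ wormholeHeights n ∧
      (∀ τ ∈ wormholeHeights n, t < τ → t + b ≤ τ) ∧ distAbove n t = ENNReal.ofReal b := by
  have hp : (0 : ℝ) < 1 / 3 ^ n := by positivity
  have e2 : (2 : ℝ) / 3 ^ n = 2 * (1 / 3 ^ n) := by ring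
  have e3 : (3 : ℝ) / 3 ^ n = 3 * (1 / 3 ^ n) := by ring
  obtain ⟨τ₀, hτ₀, h1, h2⟩ := exists_mem_wormholeHeights hn (a := t + 1 / 3 ^ n)
    (b := t + 3 / 3 ^ n) (by linarith) (by linarith) (by linarith)
  obtain ⟨τ, ⟨hτ, htτ⟩, hmin⟩ := exists_min_image (wormholeHeights n ∩ Ioi t) id
    ((wormholeHeights_finite n).inter_of_left _) ⟨τ₀, hτ₀, by simp only [mem_Ioi]; linarith⟩
  have htτ' : t < τ := htτ
  have hmin' : ∀ τ' ∈ wormholeHeights n, t < τ' → τ ≤ τ' := fun τ' h h' => hmin τ' ⟨h, h'⟩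
  refine ⟨τ - t, by linarith, ?_, by simpa using hτ, by simpa using hmin', le_antisymm ?_ ?_⟩
  · linarith [hmin' τ₀ hτ₀ (by linarith)]
  · exact iInf₂_le (τ - t) ⟨by linarith, by simpa using hτ⟩
  · refine le_iInf₂ fun s hs => ENNReal.ofReal_le_ofReal ?_
    linarith [hmin' _ hs.2 (by linarith [hs.1])]

theorem exists_distBelow {n : ℕ} (hn : n ≠ 0) {t : ℝ} (ht : t ≤ 1) (h : 3 / 3 ^ n ≤ t) :
    ∃ a : ℝ, 0 < a ∧ a ≤ 3 / 3 ^ n ∧ t - a ∈ wormholeHeights n ∧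
      (∀ τ ∈ wormholeHeights n, τ < t → τ ≤ t - a) ∧ distBelow n t = ENNReal.ofReal a := by
  have hp : (0 : ℝ) < 1 / 3 ^ n := by positivity
  have e2 : (2 : ℝ) / 3 ^ n = 2 * (1 / 3 ^ n) := by ring
  have e3 : (3 : ℝ) / 3 ^ n = 3 * (1 / 3 ^ n) := by ring
  obtain ⟨τ₀, hτ₀, h1, h2⟩ := exists_mem_wormholeHeights hn (a := t - 3 / 3 ^ n)
    (b := t - 1 / 3 ^ n) (by linarith) (by linarith) (by linarith)
  obtain ⟨τ, ⟨hτ, htτ⟩, hmax⟩ := exists_max_image (wormholeHeights n ∩ Iio t) id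
    ((wormholeHeights_finite n).inter_of_left _) ⟨τ₀, hτ₀, by simp only [mem_Iio]; linarith⟩
  have htτ' : τ < t := htτ
  have hmax' : ∀ τ' ∈ wormholeHeights n, τ' < t → τ' ≤ τ := fun τ' h h' => hmax τ' ⟨h, h'⟩
  refine ⟨t - τ, by linarith, ?_, by simpa using hτ, by simpa using hmax', le_antisymm ?_ ?_⟩
  · linarith [hmax' τ₀ hτ₀ (by linarith)]
  · exact iInf₂_le (t - τ) ⟨by linarith, by simpa using hτ⟩
  · refine le_iInf₂ fun s hs => ENNReal.ofReal_le_ofReal ?_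
    linarith [hmax' _ hs.2 (by linarith [hs.1])]

theorem inv_le_ofReal_div_and_le_iff {a b : ℝ} (ha : 0 < a) (hb : 0 < b) {C : ℝ≥0} (hC : 1 ≤ C) :
    ((C : ℝ≥0∞)⁻¹ ≤ ENNReal.ofReal b / ENNReal.ofReal a ∧
      ENNReal.ofReal b / ENNReal.ofReal a ≤ C) ↔ a ≤ C * b ∧ b ≤ C * a := by
  have hC0 : (0 : ℝ) < C := lt_of_lt_of_le one_pos (by exact_mod_cast hC)
  rw [← ENNReal.ofReal_div_of_pos ha, ← ENNReal.ofReal_coe_nnreal,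
    ← ENNReal.ofReal_inv_of_pos hC0, ENNReal.ofReal_le_ofReal_iff (by positivity),
    ENNReal.ofReal_le_ofReal_iff hC0.le, div_le_iff₀ ha, le_div_iff₀ ha, inv_mul_le_iff₀ hC0]

theorem exists_pow_scale {ε : ℝ} (hε : 0 < ε) : ∃ N : ℕ, ∀ n, N ≤ n → 3 / (3 : ℝ) ^ n ≤ ε := by
  obtain ⟨N, hN⟩ := exists_pow_lt_of_lt_one (show (0 : ℝ) < ε / 3 by positivity)
    (by norm_num : (1 / 3 : ℝ) < 1)
  refine ⟨N, fun n hn => ?_⟩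
  have h1 : (1 / 3 : ℝ) ^ n ≤ (1 / 3) ^ N := pow_le_pow_of_le_one (by norm_num) (by norm_num) hn
  have h2 : 3 / (3 : ℝ) ^ n = 3 * (1 / 3) ^ n := by rw [one_div_pow]; ring
  linarith

/-- Since `3 ^ (-n) ≤ D_n⁺ + D_n⁻ ≤ 6 / 3 ^ n`, the quotient `D_n⁺ / D_n⁻` is controlled if and only
if both distances are comparable to `3 ^ (-n)`. -/
theorem comparableHeights_eq_iUnion : comparableHeights = ⋃ j, separatedHeights j := by
  have scale : ∀ {t : ℝ}, t ∈ Ioo (0 : ℝ) 1 →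
      ∃ N : ℕ, ∀ n, N ≤ n → n ≠ 0 ∧ 3 / (3 : ℝ) ^ n ≤ t ∧ 3 / (3 : ℝ) ^ n ≤ 1 - t := by
    intro t ht
    obtain ⟨N, hN⟩ := exists_pow_scale (lt_min ht.1 (sub_pos.2 ht.2))
    refine ⟨N + 1, fun n hn => ⟨by omega, ?_⟩⟩
    exact le_min_iff.1 (hN n (by omega))
  ext t
  rw [mem_iUnion]
  constructor
  · rintro ⟨ht, C, hC, N, h⟩
    obtain ⟨N', hN'⟩ := scale ht
    obtain ⟨M, hM⟩ := exists_nat_ge (C : ℝ)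
    refine ⟨max M (max N N'), ht, fun n hn τ hτ hne => ?_⟩
    simp only [max_le_iff] at hn
    obtain ⟨hn0, h0, h1⟩ := hN' n hn.2.2
    obtain ⟨b, hb, -, hbJ, hbm, hbD⟩ := exists_distAbove hn0 ht.1.le h1
    obtain ⟨a, ha, -, haJ, ham, haD⟩ := exists_distBelow hn0 ht.2.le h0
    have h2 := h n hn.2.1
    rw [hbD, haD, inv_le_ofReal_div_and_le_iff ha hb hC] at h2
    have h3 := add_inv_pow_le_of_lt haJ hbJ (by linarith)
    have hMC : (C : ℝ) ≤ (max M (max N N') : ℕ) := hM.trans (by exact_mod_cast le_max_left _ _)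
    rcases lt_or_gt_of_ne hne with h | h
    · have h4 : a ≤ |τ - t| := by
        rw [abs_of_neg (by linarith)]
        linarith [ham τ hτ h]
      calc 1 / 3 ^ n ≤ (C + 1) * a := by linarith
        _ ≤ _ := by gcongr
    · have h4 : b ≤ |τ - t| := by
        rw [abs_of_pos (by linarith)]
        linarith [hbm τ hτ h]
      calc 1 / 3 ^ n ≤ (C + 1) * b := by linarith
        _ ≤ _ := by gcongr
  · rintro ⟨j, ht, h⟩
    obtain ⟨N', hN'⟩ := scale ht
    refine ⟨ht, 3 * (j + 1), ?_, max j N', fun n hn => ?_⟩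
    · have : (0 : ℝ≥0) ≤ j := zero_le
      rw [← NNReal.coe_le_coe] at this ⊢
      push_cast at this ⊢
      linarith
    simp only [max_le_iff] at hn
    obtain ⟨hn0, h0, h1⟩ := hN' n hn.2
    obtain ⟨b, hb, hb3, hbJ, -, hbD⟩ := exists_distAbove hn0 ht.1.le h1
    obtain ⟨a, ha, ha3, haJ, -, haD⟩ := exists_distBelow hn0 ht.2.le h0
    have h2 := h n hn.1 _ hbJ (by linarith)
    have h3 := h n hn.1 _ haJ (by linarith)
    rw [add_sub_cancel_left, abs_of_pos hb] at h2
    rw [sub_sub_cancel_left, abs_neg, abs_of_pos ha] at h3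
    have e3 : (3 : ℝ) / 3 ^ n = 3 * (1 / 3 ^ n) := by ring
    rw [hbD, haD, inv_le_ofReal_div_and_le_iff ha hb]
    · push_cast
      constructor <;> linarith
    · have : (0 : ℝ≥0) ≤ j := zero_le
      rw [← NNReal.coe_le_coe] at this ⊢
      push_cast at this ⊢
      linarith

/-! ### Differentiability above separated heights -/

theorem hasLineDeriv_iff {f : LaaksoSpace → ℝ} {p : IK} {L : ℝ} : HasLineDeriv f p L ↔
    ∀ ε > 0, ∃ δ > 0, ∀ s : Icc (0 : ℝ) 1, |(s : ℝ) - p.1| < δ →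
      |f (proj (s, p.2)) - f (proj p) - L * (s - p.1)| ≤ ε * |(s : ℝ) - p.1| := by
  have hquot : ∀ s : Icc (0 : ℝ) 1, s ≠ p.1 →
      |(f (proj (s, p.2)) - f (proj p)) / ((s : ℝ) - p.1) - L| =
        |f (proj (s, p.2)) - f (proj p) - L * (s - p.1)| / |(s : ℝ) - p.1| := by
    intro s hs
    have : (s : ℝ) - p.1 ≠ 0 := sub_ne_zero.2 fun h => hs (Subtype.ext h)
    rw [← abs_div]
    congr 1
    field_simp
  have hpos : ∀ s : Icc (0 : ℝ) 1, s ≠ p.1 → 0 < |(s : ℝ) - p.1| := fun s hs =>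
    abs_pos.2 (sub_ne_zero.2 fun h => hs (Subtype.ext h))
  unfold HasLineDeriv
  rw [Metric.tendsto_nhdsWithin_nhds]
  constructor
  · intro h ε hε
    obtain ⟨δ, hδ, h⟩ := h ε hε
    refine ⟨δ, hδ, fun s hs => ?_⟩
    by_cases hsp : s = p.1
    · subst hsp
      simp
    · have := h hsp hs
      rw [Real.dist_eq, hquot s hsp, div_lt_iff₀ (hpos s hsp)] at this
      exact this.le
  · intro h ε hε
    obtain ⟨δ, hδ, h⟩ := h (ε / 2) (by positivity)
    refine ⟨δ, hδ, fun s hsp hs => ?_⟩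
    have h1 := h s hs
    rw [Real.dist_eq, hquot s hsp, div_lt_iff₀ (hpos s hsp)]
    have := mul_pos hε (hpos s hsp)
    linarith

theorem lipschitzWith_lipConst {f : LaaksoSpace → ℝ} (hf : IsLipschitz f) :
    LipschitzWith (lipConst f) f := by
  have hf' : {C : ℝ≥0 | LipschitzWith C f}.Nonempty := hf
  refine LipschitzWith.of_dist_le_mul fun x y => ?_
  refine le_of_forall_pos_lt_add fun ε hε => ?_
  have hpos : 0 < ε / (dist x y + 1) := by positivity
  obtain ⟨C, hC, hlt⟩ := exists_lt_of_csInf_lt hf' (show sInf {C : ℝ≥0 | LipschitzWith C f} <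
    lipConst f + (ε / (dist x y + 1)).toNNReal from
      lt_add_of_pos_right _ (Real.toNNReal_pos.2 hpos))
  have h1 : LipschitzWith C f := hC
  have h2 : (C : ℝ) < lipConst f + ε / (dist x y + 1) := by
    have := NNReal.coe_lt_coe.2 hlt
    rwa [NNReal.coe_add, Real.coe_toNNReal _ hpos.le] at this
  have h3 : ε / (dist x y + 1) * dist x y < ε := by
    rw [div_mul_eq_mul_div, div_lt_iff₀ (by positivity)]
    linarith
  calc dist (f x) (f y) ≤ C * dist x y := h1.dist_le_mul x y
    _ ≤ (lipConst f + ε / (dist x y + 1)) * dist x y := by gcongr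
    _ < _ := by linarith

/-- Among the representatives of `[t, u]` there are two such that each line is reached from one of
them without changing a digit whose wormhole level contains `t`. -/
theorem exists_representatives (t : Icc (0 : ℝ) 1) (u : cantorSet) :
    ∃ c : Bool → cantorSet, (∀ b, proj (t, c b) = proj (t, u)) ∧
      ∀ v, ∃ b, ∀ k, bits (c b) k ≠ bits v k → (t : ℝ) ∉ wormholeHeights (k + 1) := by
  by_cases h : ∃ k, (t : ℝ) ∈ wormholeHeights (k + 1)
  · obtain ⟨k, hk⟩ := h
    refine ⟨fun b => ofBits (Function.update (bits u) k b), fun b => ?_, fun v => ⟨bits v k, ?_⟩⟩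
    · rw [proj_update hk, ofBits_bits]
    · intro i hi hti
      obtain rfl := wormholeHeights_disjoint hti hk
      simp [bits_ofBits] at hi
  · push Not at h
    exact ⟨fun _ => u, fun _ => rfl, fun v => ⟨true, fun k _ => h k⟩⟩

/-- If `y` is joined to a point `z₁` above it and to a point `z₂` below it by geodesics of monotone
height, then the Lipschitz condition, with constant `|L|`, bounds the deviation of `f` at `y` from the
affine function of slope `L` by its deviations at `z₁` and `z₂`. -/
theorem abs_sub_sub_le_of_geodesics {f : LaaksoSpace → ℝ} {c : ℝ≥0} (hf : LipschitzWith c f)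
    {L : ℝ} (hL : |L| = c) {x y z₁ z₂ : LaaksoSpace} {e : ℝ}
    (h₁ : dist y z₁ ≤ height z₁ - height y) (h₂ : dist y z₂ ≤ height y - height z₂)
    (e₁ : |f z₁ - f x - L * (height z₁ - height x)| ≤ e)
    (e₂ : |f z₂ - f x - L * (height z₂ - height x)| ≤ e) :
    |f y - f x - L * (height y - height x)| ≤ e := by
  have l₁ : |f y - f z₁| ≤ c * (height z₁ - height y) :=
    (hf.dist_le_mul y z₁).trans (by gcongr)
  have l₂ : |f y - f z₂| ≤ c * (height y - height z₂) :=
    (hf.dist_le_mul y z₂).trans (by gcongr)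
  rw [abs_le] at *
  rcases abs_choice L with h | h <;> rw [← hL, h] at l₁ l₂ <;> constructor <;> linarith

theorem exists_pos_le_abs_sub (j : ℕ) (t : ℝ) :
    ∃ δ > 0, ∀ n < j, ∀ τ ∈ wormholeHeights n, τ ≠ t → δ ≤ |τ - t| := by
  have hfin : ((⋃ n ∈ Iio j, wormholeHeights n) \ {t}).Finite :=
    ((finite_Iio j).biUnion fun n _ => wormholeHeights_finite n).sdiff
  obtain ⟨δ, hδ, hball⟩ := Metric.isOpen_iff.1 hfin.isClosed.isOpen_compl t (by simp)
  refine ⟨δ, hδ, fun n hn τ hτ hne => ?_⟩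
  by_contra! h
  exact hball (show τ ∈ Metric.ball t δ from h) ⟨mem_biUnion hn hτ, hne⟩

theorem isDifferentiableAt_of_mem_separatedHeights {j : ℕ} {t : Icc (0 : ℝ) 1} {u : cantorSet}
    (ht : (t : ℝ) ∈ separatedHeights j) {f : LaaksoSpace → ℝ} {c : ℝ≥0} (hf : LipschitzWith c f)
    {L : ℝ} (hL : |L| = c) (hD : HasDirectionalDeriv f (proj (t, u)) L) :
    IsDifferentiableAt f (proj (t, u)) := by
  obtain ⟨⟨ht0, ht1⟩, hsep⟩ := ht
  obtain ⟨r, hr, hrv⟩ := exists_representatives t u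
  obtain ⟨δ₀, hδ₀, hfar⟩ := exists_pos_le_abs_sub j t
  have hK : (0 : ℝ) < 2 * j + 3 := by positivity
  refine ⟨L, ?_⟩
  rw [Metric.tendsto_nhdsWithin_nhds]
  intro ε hε
  have hder : ∀ b, ∃ δ > 0, ∀ s : Icc (0 : ℝ) 1, |(s : ℝ) - t| < δ →
      |f (proj (s, r b)) - f (proj (t, r b)) - L * (s - t)| ≤
        ε / (2 * (2 * j + 3)) * |(s : ℝ) - t| :=
    fun b => hasLineDeriv_iff.1 (hD (t, r b) (hr b)) _ (by positivity)
  choose δ hδ hder using hder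
  refine ⟨min δ₀ (min (t : ℝ) (min (1 - t) (min (δ true) (δ false))) / (2 * j + 3)), ?_, ?_⟩
  · have : 0 < min (t : ℝ) (min (1 - t) (min (δ true) (δ false))) := by
      simp only [lt_min_iff, sub_pos]
      exact ⟨ht0, ht1, hδ _, hδ _⟩
    positivity
  intro y hyx hd
  obtain ⟨⟨y₁, v⟩, rfl⟩ : ∃ p, proj p = y := Quot.exists_rep y
  obtain ⟨b, hb⟩ := hrv v
  rw [lt_min_iff, lt_div_iff₀ hK] at hd
  have hx := hr b
  have hdb := hder b
  have hd0 : 0 < dist (proj (y₁, v)) (proj (t, u)) := dist_pos.2 hyx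
  set d := dist (proj (y₁, v)) (proj (t, u)) with hddef
  obtain ⟨hd1, hd2⟩ := hd
  simp only [lt_min_iff] at hd2
  have hdδ : d * (2 * j + 3) < δ b := by
    cases b
    · exact hd2.2.2.2
    · exact hd2.2.2.1
  have hy : |(y₁ : ℝ) - t| ≤ d := abs_sub_le_dist_proj (y₁, v) (t, u)
  -- all digits in which the lines of `x` and `y` differ have order at least `log (1 / d)`
  have hdigit : ∀ k, bits (r b) k ≠ bits v k → 1 / (3 : ℝ) ^ (k + 1) ≤ (j + 1) * d := by
    intro k hk
    obtain ⟨τ, hτ, -, h2⟩ := exists_wormholeHeight_near (p := (y₁, v)) (r := (t, r b)) (k := k)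
      hk.symm
    rw [hx, ← hddef] at h2
    have hne : τ ≠ t := by
      rintro rfl
      exact hb k hk hτ
    have hjk : j ≤ k + 1 := by
      by_contra! hlt
      have := hfar _ hlt τ hτ hne
      simp only at h2
      linarith
    exact (hsep _ hjk τ hτ hne).trans (by gcongr)
  have hy' := abs_le.1 hy
  -- the intervals between `y₁` and the heights of `z₁`, `z₂` are long enough to meet these levels
  let z₁ : Icc (0 : ℝ) 1 := ⟨t + d * (2 * j + 3), by positivity, by linarith⟩
  let z₂ : Icc (0 : ℝ) 1 := ⟨t - d * (2 * j + 3), by linarith, by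
    have := t.2.2
    nlinarith⟩
  have hz₁ : (z₁ : ℝ) = t + d * (2 * j + 3) := rfl
  have hz₂ : (z₂ : ℝ) = t - d * (2 * j + 3) := rfl
  have hj0 : 0 ≤ d * j := by positivity
  have hgeo₁ : dist (proj (y₁, v)) (proj (z₁, r b)) ≤ (z₁ : ℝ) - y₁ := by
    refine dist_proj_le_of_le (by rw [hz₁]; linarith) fun k hk => ?_
    refine exists_mem_wormholeHeights (by omega) y₁.2.1 z₁.2.2 ?_
    have := hdigit k hk.symm
    rw [show (2 : ℝ) / 3 ^ (k + 1) = 2 * (1 / 3 ^ (k + 1)) by ring, hz₁]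
    linarith
  have hgeo₂ : dist (proj (y₁, v)) (proj (z₂, r b)) ≤ (y₁ : ℝ) - z₂ := by
    rw [dist_comm]
    refine dist_proj_le_of_le (by rw [hz₂]; linarith) fun k hk => ?_
    refine exists_mem_wormholeHeights (by omega) z₂.2.1 y₁.2.2 ?_
    have := hdigit k hk
    rw [show (2 : ℝ) / 3 ^ (k + 1) = 2 * (1 / 3 ^ (k + 1)) by ring, hz₂]
    linarith
  have a₁ : |(z₁ : ℝ) - t| = d * (2 * j + 3) := by
    rw [hz₁, add_sub_cancel_left, abs_of_pos (by positivity)]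
  have a₂ : |(z₂ : ℝ) - t| = d * (2 * j + 3) := by
    rw [hz₂, sub_sub_cancel_left, abs_neg, abs_of_pos (by positivity)]
  have e₁ := hdb z₁ (by rw [a₁]; exact hdδ)
  have e₂ := hdb z₂ (by rw [a₂]; exact hdδ)
  rw [a₁, hx] at e₁
  rw [a₂, hx] at e₂
  have hmain := abs_sub_sub_le_of_geodesics hf hL (x := proj (t, u)) hgeo₁ hgeo₂ e₁ e₂
  rw [Real.dist_eq, sub_zero, abs_div, abs_of_pos hd0, div_lt_iff₀ hd0]
  refine hmain.trans_lt ?_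
  have : ε / (2 * (2 * j + 3)) * (d * (2 * j + 3)) = ε * d / 2 := by
    field_simp
  rw [this]
  have := mul_pos hε hd0
  linarith

/-! ### Failure of differentiability above the other heights -/

theorem HasLineDeriv.abs_le {f : LaaksoSpace → ℝ} {p : IK} {L : ℝ} (h : HasLineDeriv f p L)
    {C : ℝ≥0} (hf : LipschitzWith C f) : |L| ≤ C := by
  refine le_of_tendsto h.abs (eventually_mem_nhdsWithin.mono fun s hs => ?_)
  have hne : (s : ℝ) - p.1 ≠ 0 := sub_ne_zero.2 fun h => hs (Subtype.ext h)
  rw [abs_div, div_le_iff₀ (abs_pos.2 hne)]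
  calc |f (proj (s, p.2)) - f (proj p)| ≤ C * dist (proj (s, p.2)) (proj p) := hf.dist_le_mul _ _
    _ ≤ C * |(s : ℝ) - p.1| := by
      gcongr
      exact dist_proj_le_abs s p.1 p.2

theorem abs_height_sub_le (x y : LaaksoSpace) : |height x - height y| ≤ dist x y := by
  obtain ⟨p, rfl⟩ : ∃ p, proj p = x := Quot.exists_rep x
  obtain ⟨r, rfl⟩ : ∃ p, proj p = y := Quot.exists_rep y
  exact abs_sub_le_dist_proj p r

theorem bits_eq_of_proj_eq {t : Icc (0 : ℝ) 1} {u w : cantorSet} (h : proj (t, w) = proj (t, u))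
    {k : ℕ} (hk : (t : ℝ) ∉ wormholeHeights (k + 1)) : bits w k = bits u k := by
  by_contra hne
  obtain ⟨τ, hτ, h1, -⟩ := exists_wormholeHeight_near (p := (t, w)) (r := (t, u)) (k := k) hne
  rw [h, dist_self] at h1
  have : τ = t := sub_eq_zero.1 (abs_nonpos_iff.1 h1)
  exact hk (this ▸ hτ)

/-- The point at height `t` on the line that differs from the line over `u` in the digit of index
`k` only. -/
noncomputable def flipped (t : Icc (0 : ℝ) 1) (u : cantorSet) (k : ℕ) : LaaksoSpace :=
  proj (t, ofBits (Function.update (bits u) k (!bits u k)))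

/-- The smallest of the function `σ (h - t)`, of slope `σ` on all lines, and of the cones of slope
`1` with the values `-a j` at the points `y j`. -/
noncomputable def indentedHeight (σ t : ℝ) (y : ℕ → LaaksoSpace) (a : ℕ → ℝ) (z : LaaksoSpace) : ℝ :=
  min (σ * (height z - t)) (⨅ j, (dist z (y j) - a j))

section indentedHeight

variable {σ t : ℝ} {y : ℕ → LaaksoSpace} {a : ℕ → ℝ}

theorem bddBelow_range_dist_sub (ha : ∀ j, a j ≤ 1) (z : LaaksoSpace) :
    BddBelow (range fun j => dist z (y j) - a j) := by
  refine ⟨-1, ?_⟩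
  rintro _ ⟨j, rfl⟩
  have h1 := ha j
  have h2 : 0 ≤ dist z (y j) := dist_nonneg
  simp only
  linarith

theorem lipschitzWith_indentedHeight (hσ : σ = 1 ∨ σ = -1) (ha : ∀ j, a j ≤ 1) :
    LipschitzWith 1 (indentedHeight σ t y a) := by
  have h1 : LipschitzWith 1 fun z => σ * (height z - t) := by
    refine LipschitzWith.of_le_add fun x z => ?_
    have := abs_le.1 (abs_height_sub_le x z)
    rcases hσ with rfl | rfl <;> linarith
  have h2 : LipschitzWith 1 fun z => ⨅ j, (dist z (y j) - a j) := by
    refine LipschitzWith.of_le_add fun x z => ?_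
    rw [← sub_le_iff_le_add]
    refine le_ciInf fun j => ?_
    have h3 : ⨅ j, (dist x (y j) - a j) ≤ dist x (y j) - a j :=
      ciInf_le (bddBelow_range_dist_sub ha x) j
    have := dist_triangle x z (y j)
    linarith
  exact max_self (1 : ℝ≥0) ▸ h1.min h2

theorem indentedHeight_apply_le (ha : ∀ j, a j ≤ 1) (j : ℕ) :
    indentedHeight σ t y a (y j) ≤ -a j := by
  refine (min_le_right _ _).trans ((ciInf_le (bddBelow_range_dist_sub ha (y j)) j).trans ?_)
  simp

end indentedHeight

/-- Let `t - σ a_j` be the point of the wormhole level of order `n_j + 1` closest to `t`, and let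
the closest one on the other side be at a distance `≥ b_j`, where `a_j / b_j → 0`. On the lines
through `[t, u]` the cones with values `-a_j` at the points that differ from `[t, u]` in the digit
of index `n_j` are above `σ (h - t)`, but for an error that is negligible at height `t`: a path from
such a line to the vertex has to descend to the height `t - σ a_j`, or to climb to the height
`t + σ b_j`. So the function is as steep at `[t, u]` as its Lipschitz constant allows, and the
vertices, which are at distance at most `2 a_j`, violate differentiability. -/
theorem proj_notMem_of_gaps {t : Icc (0 : ℝ) 1} {u : cantorSet} {σ : ℝ} (hσ : σ = 1 ∨ σ = -1)
    {n : ℕ → ℕ} {a b : ℕ → ℝ} (ha : ∀ j, 0 < a j) (hb : ∀ j, b j ≤ 1)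
    (hab : ∀ j, (j + 2) * a j ≤ b j) (hJ : ∀ j, (t : ℝ) - σ * a j ∈ wormholeHeights (n j + 1))
    (hfar : ∀ j, ∀ τ ∈ wormholeHeights (n j + 1), a j ≤ |τ - t|)
    (hfar' : ∀ j, ∀ τ ∈ wormholeHeights (n j + 1), 0 < σ * (τ - t) → b j ≤ σ * (τ - t)) :
    proj (t, u) ∉ maximalityImpliesDiff := by
  intro hM
  have ha' : ∀ j, a j ≤ 1 / (j + 2) := by
    intro j
    rw [le_div_iff₀ (by positivity), mul_comm]
    exact (hab j).trans (hb j)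
  have ha1 : ∀ j, a j ≤ 1 := fun j => (ha' j).trans (by
    rw [div_le_one (by positivity)]
    linarith [j.cast_nonneg (α := ℝ)])
  have htJ : ∀ j, (t : ℝ) ∉ wormholeHeights (n j + 1) := by
    intro j h
    have := hfar j _ h
    rw [sub_self, abs_zero] at this
    linarith [ha j]
  have habs : ∀ r, |σ * r| = |r| := by
    intro r
    rcases hσ with rfl | rfl <;> simp
  set y : ℕ → LaaksoSpace := fun j => flipped t u (n j) with hy
  -- every path from a line through `[t, u]` to `y j` meets the level of order `n j + 1`
  have hdist : ∀ (j : ℕ) (w : cantorSet), proj (t, w) = proj (t, u) → ∀ s : Icc (0 : ℝ) 1,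
      ∃ τ ∈ wormholeHeights (n j + 1), |τ - s| ≤ dist (proj (s, w)) (y j) ∧
        |τ - t| ≤ dist (proj (s, w)) (y j) := by
    intro j w hw s
    refine exists_wormholeHeight_near (p := (s, w)) (r := (t, _)) (k := n j) ?_
    simp [bits_ofBits, bits_eq_of_proj_eq hw (htJ j)]
  set f := indentedHeight σ t y a with hf
  have hlip : LipschitzWith 1 f := lipschitzWith_indentedHeight hσ ha1
  have hle : ∀ (w : cantorSet) (s : Icc (0 : ℝ) 1), f (proj (s, w)) ≤ σ * (s - t) :=
    fun w s => min_le_left _ _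
  have hge : ∀ (w : cantorSet), proj (t, w) = proj (t, u) → ∀ (s : Icc (0 : ℝ) 1) (ε : ℝ),
      0 ≤ ε → ε ≤ 1 → (∀ j : ℕ, |(s : ℝ) - t| < a j ∨ 1 / ((j : ℝ) + 2) ≤ ε) →
      σ * (s - t) - ε * |(s : ℝ) - t| ≤ f (proj (s, w)) := by
    intro w hw s ε hε0 hε1 hs
    have hε : 0 ≤ ε * |(s : ℝ) - t| := by positivity
    refine le_min (by rw [height_proj]; linarith) (le_ciInf fun j => ?_)
    obtain ⟨τ, hτ, h1, h2⟩ := hdist j w hw s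
    have h3 := (abs_sub_le_dist_proj (s, w)
      (t, ofBits (Function.update (bits u) (n j) (!bits u (n j)))))
    change |(s : ℝ) - t| ≤ dist (proj (s, w)) (y j) at h3
    have h4 := hfar j τ hτ
    rcases le_or_gt (σ * (s - t)) 0 with hneg | hpos
    · linarith
    have hst : |(s : ℝ) - t| = σ * (s - t) := by rw [← habs, abs_of_pos hpos]
    rw [hst] at h3 hε ⊢
    rcases le_or_gt (σ * (τ - t)) 0 with hτt | hτt
    · have h5 : |τ - t| = -(σ * (τ - t)) := by rw [← habs, abs_of_nonpos hτt]
      have h6 : -(σ * (τ - s)) ≤ |τ - s| := by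
        rw [← habs]
        exact neg_le_abs _
      linarith
    · have h5 := hfar' j τ hτ hτt
      have h6 : |τ - t| = σ * (τ - t) := by rw [← habs, abs_of_pos hτt]
      have h7 : b j ≤ dist (proj (s, w)) (y j) := by linarith
      rcases hs j with hj | hj
      · rw [hst] at hj
        have : 0 ≤ (j : ℝ) * a j := mul_nonneg j.cast_nonneg (ha j).le
        linarith [hab j]
      · have h8 : a j ≤ ε * b j := by
          have hbj : 0 ≤ b j := (mul_nonneg (by positivity) (ha j).le).trans (hab j)
          calc a j ≤ 1 / ((j : ℝ) + 2) * b j := by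
                rw [one_div_mul_eq_div, le_div_iff₀ (by positivity), mul_comm]
                exact hab j
            _ ≤ ε * b j := by gcongr
        rcases le_total (b j) (σ * (s - t)) with hb' | hb'
        · have : ε * b j ≤ ε * (σ * (s - t)) := by gcongr
          linarith
        · have : (1 - ε) * (σ * (s - t)) ≤ (1 - ε) * b j := by
            gcongr
          linarith
  have hf0 : f (proj (t, u)) = 0 := by
    have h1 := hle u t
    have h2 := hge u rfl t 1 zero_le_one le_rfl fun j => Or.inl (by simpa using ha j)
    simp only [sub_self, mul_zero, abs_zero] at h1 h2
    linarith
  have hline : ∀ w, proj (t, w) = proj (t, u) → HasLineDeriv f (t, w) σ := by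
    intro w hw
    rw [hasLineDeriv_iff]
    intro ε hε
    set ε' := min ε 1 with hε'
    have hε'0 : 0 < ε' := lt_min hε one_pos
    obtain ⟨N, hN⟩ := exists_nat_one_div_lt hε'0
    obtain ⟨δ, hδ, hδa⟩ : ∃ δ > 0, ∀ j ∈ Finset.range N, δ < a j := by
      have h1 : ∀ᶠ δ in 𝓝[>] (0 : ℝ), ∀ j ∈ Finset.range N, δ < a j := by
        rw [Filter.eventually_all_finset]
        exact fun j _ => nhdsWithin_le_nhds (gt_mem_nhds (ha j))
      obtain ⟨δ, h2, h3⟩ := (h1.and self_mem_nhdsWithin).exists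
      exact ⟨δ, h3, h2⟩
    refine ⟨δ, hδ, fun s hs => ?_⟩
    have h1 := hle w s
    have h2 := hge w hw s ε' hε'0.le (min_le_right _ _) fun j => by
      by_cases hj : j < N
      · exact Or.inl (hs.trans (hδa j (Finset.mem_range.2 hj)))
      · right
        refine le_trans ?_ hN.le
        have : (N : ℝ) ≤ j := by exact_mod_cast not_lt.1 hj
        gcongr
        linarith
    have h3 : ε' * |(s : ℝ) - t| ≤ ε * |(s : ℝ) - t| := by
      gcongr
      exact min_le_left _ _
    rw [hw, hf0, abs_le]
    simp only
    constructor <;> linarith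
  have hmax : HasMaximalDirectionalDeriv f (proj (t, u)) := by
    refine ⟨σ, ?_, ?_⟩
    · rintro ⟨t', w⟩ hw
      obtain rfl : t' = t := Subtype.ext (congrArg height hw)
      exact hline w hw
    · have h1 := (hline u rfl).abs_le (lipschitzWith_lipConst ⟨1, hlip⟩)
      have h2 : (lipConst f : ℝ) ≤ 1 := by
        exact_mod_cast (csInf_le' hlip : lipConst f ≤ 1)
      have h3 : |σ| = 1 := by rcases hσ with rfl | rfl <;> simp
      linarith
  obtain ⟨D, hD⟩ := hM f ⟨1, hlip⟩ hmax
  rw [Metric.tendsto_nhdsWithin_nhds] at hD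
  obtain ⟨δ, hδ, hD⟩ := hD (1 / 2) (by norm_num)
  obtain ⟨j, hj⟩ := exists_nat_one_div_lt (half_pos hδ)
  have hyx : dist (y j) (proj (t, u)) ≤ 2 * a j := by
    set τ : Icc (0 : ℝ) 1 := ⟨_, Ioo_subset_Icc_self (wormholeHeights_subset_Ioo _ (hJ j))⟩ with hτ
    have h1 := dist_proj_le_abs t τ (ofBits (Function.update (bits u) (n j) (!bits u (n j))))
    have h2 := dist_proj_le_abs τ t u
    rw [proj_update (t := τ) (hJ j), ofBits_bits] at h1
    have h3 : |(t : ℝ) - τ| = a j := by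
      simp only [hτ, sub_sub_cancel, habs, abs_of_pos (ha j)]
    rw [h3] at h1
    rw [abs_sub_comm, h3] at h2
    have := dist_triangle (y j) (proj (τ, u)) (proj (t, u))
    change dist (y j) (proj (τ, u)) ≤ a j at h1
    linarith
  have hpos : 0 < dist (y j) (proj (t, u)) := by
    obtain ⟨τ, hτ, -, h2⟩ := hdist j u rfl t
    rw [dist_comm]
    exact (ha j).trans_le ((hfar j τ hτ).trans h2)
  have hclose : dist (y j) (proj (t, u)) < δ := by
    have : 1 / ((j : ℝ) + 2) ≤ 1 / (j + 1) := by
      gcongr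
      norm_num
    linarith [ha' j]
  have hlt := hD (dist_pos.1 hpos) hclose
  have hheight : height (y j) - height (proj (t, u)) = 0 := sub_self _
  have hval : f (y j) ≤ -a j := indentedHeight_apply_le ha1 j
  rw [hheight, hf0, Real.dist_eq, mul_zero, sub_zero, sub_zero, sub_zero, abs_div,
    abs_of_pos hpos, div_lt_iff₀ hpos, abs_of_neg (by linarith [ha j])] at hlt
  linarith

theorem inv_pow_le_abs_sub_of_ne {n : ℕ} {s t : ℝ} (hs : s ∈ wormholeHeights n)
    (ht : t ∈ wormholeHeights n) (hst : s ≠ t) : 1 / 3 ^ n ≤ |s - t| := by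
  rcases lt_or_gt_of_ne hst with h | h
  · rw [abs_of_neg (by linarith)]
    linarith [add_inv_pow_le_of_lt hs ht h]
  · rw [abs_of_pos (by linarith)]
    linarith [add_inv_pow_le_of_lt ht hs h]

theorem proj_notMem_of_notMem_iUnion {t : Icc (0 : ℝ) 1} {u : cantorSet}
    (ht : (t : ℝ) ∈ Ioo (0 : ℝ) 1) (hS : ∀ j, (t : ℝ) ∉ separatedHeights j) :
    proj (t, u) ∉ maximalityImpliesDiff := by
  have hex : ∀ j : ℕ, ∃ n, j ≤ n ∧ ∃ τ ∈ wormholeHeights n, τ ≠ t ∧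
      (j + 1) * |τ - t| < 1 / 3 ^ n := by
    intro j
    by_contra! h
    exact hS j ⟨ht, h⟩
  -- infinitely many of these exceptionally close points lie on the same side of `t`
  obtain ⟨σ, hσ, hex⟩ : ∃ σ : ℝ, (σ = 1 ∨ σ = -1) ∧ ∀ j : ℕ, ∃ n, ∃ τ ∈ wormholeHeights (n + 1),
      0 < σ * (t - τ) ∧ (j + 1) * (σ * (t - τ)) < 1 / 3 ^ (n + 1) := by
    by_contra! hno
    obtain ⟨j₁, h₁⟩ := hno 1 (Or.inl rfl)
    obtain ⟨j₂, h₂⟩ := hno (-1) (Or.inr rfl)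
    obtain ⟨n, -, τ, hτ, hne, hlt⟩ := hex (max j₁ j₂)
    cases n with
    | zero => simp [wormholeHeights_zero] at hτ
    | succ n =>
      have hj₁ : (j₁ : ℝ) ≤ (max j₁ j₂ : ℕ) := by exact_mod_cast le_max_left _ _
      have hj₂ : (j₂ : ℝ) ≤ (max j₁ j₂ : ℕ) := by exact_mod_cast le_max_right _ _
      rcases lt_or_gt_of_ne hne with h | h
      · have := h₁ n τ hτ (by linarith)
        rw [abs_of_neg (by linarith)] at hlt
        have : ((j₁ : ℝ) + 1) * (t - τ) ≤ ((max j₁ j₂ : ℕ) + 1) * (t - τ) := by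
          gcongr
        linarith
      · have := h₂ n τ hτ (by linarith)
        rw [abs_of_pos (by linarith)] at hlt
        have : ((j₂ : ℝ) + 1) * (τ - t) ≤ ((max j₁ j₂ : ℕ) + 1) * (τ - t) := by
          gcongr
        linarith
  have hex' := fun j : ℕ => hex (j + 2)
  choose n τ hτ hpos hlt using hex'
  have hσσ : σ * σ = 1 := by rcases hσ with rfl | rfl <;> norm_num
  have hτa : ∀ j, (t : ℝ) - σ * (σ * (t - τ j)) = τ j := by
    intro j
    rw [← mul_assoc, hσσ]
    ring
  have hlt' : ∀ j : ℕ, ((j : ℝ) + 3) * (σ * (t - τ j)) < 1 / 3 ^ (n j + 1) := by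
    intro j
    have := hlt j
    push_cast at this
    linarith
  have hja : ∀ j : ℕ, 0 ≤ (j : ℝ) * (σ * (t - τ j)) := fun j =>
    mul_nonneg j.cast_nonneg (hpos j).le
  refine proj_notMem_of_gaps hσ (n := n) (a := fun j => σ * (t - τ j))
    (b := fun j => 1 / 3 ^ (n j + 1) - σ * (t - τ j)) hpos (fun j => ?_) (fun j => ?_)
    (fun j => by rw [hτa]; exact hτ j) (fun j τ' hτ' => ?_) fun j τ' hτ' h => ?_
  · have : 1 / (3 : ℝ) ^ (n j + 1) ≤ 1 := by
      rw [div_le_one (by positivity)]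
      exact one_le_pow₀ (by norm_num)
    linarith [hpos j]
  · linarith [hlt' j]
  · have habs : |τ j - t| = σ * (t - τ j) := by
      rw [← abs_of_pos (hpos j), abs_mul, abs_sub_comm (t : ℝ)]
      rcases hσ with rfl | rfl <;> simp
    by_cases hne : τ' = τ j
    · rw [hne, habs]
    · have h1 := inv_pow_le_abs_sub_of_ne hτ' (hτ j) hne
      have h2 := abs_sub_le τ' t (τ j)
      rw [abs_sub_comm (t : ℝ) (τ j), habs] at h2
      linarith [hlt' j, hja j, hpos j]
  · have h0 : 0 < σ * (τ' - τ j) := by linarith [hpos j]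
    have hne : τ' ≠ τ j := by
      rintro rfl
      simp at h0
    have h1 := inv_pow_le_abs_sub_of_ne hτ' (hτ j) hne
    have h2 : |τ' - τ j| = σ * (τ' - τ j) := by
      rw [← abs_of_pos h0, abs_mul]
      rcases hσ with rfl | rfl <;> simp
    linarith

theorem wormholeHeights_subset_Icc {n : ℕ} {t : ℝ} (ht : t ∈ wormholeHeights (n + 1)) :
    1 / 3 ^ (n + 1) ≤ t ∧ t ≤ 1 - 1 / 3 ^ (n + 1) := by
  obtain ⟨k, h3, hk, rfl⟩ := mem_wormholeHeights_iff.1 ht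
  have h0 : 1 ≤ k := by
    rcases Nat.eq_zero_or_pos k with rfl | h
    · simp at h3
    · exact h
  have h1 : (1 : ℝ) ≤ k := by exact_mod_cast h0
  have h2 : (k : ℝ) + 1 ≤ 3 ^ (n + 1) := by exact_mod_cast hk
  constructor
  · gcongr
  · rw [le_sub_iff_add_le, ← add_div, div_le_one (by positivity)]
    exact h2

theorem proj_notMem_of_eq_zero_or_eq_one {t : Icc (0 : ℝ) 1} {u : cantorSet}
    (ht : (t : ℝ) = 0 ∨ (t : ℝ) = 1) : proj (t, u) ∉ maximalityImpliesDiff := by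
  have hpow : ∀ j : ℕ, ((j : ℝ) + 2) * (1 / 3 ^ (j + 1)) ≤ 1 := by
    intro j
    rw [mul_one_div, div_le_one (by positivity)]
    have : j + 1 < 3 ^ (j + 1) := Nat.lt_pow_self (by norm_num)
    exact_mod_cast this
  -- there are no wormholes beyond the end of the line, so that every `b j` is admissible there
  rcases ht with ht | ht
  · refine proj_notMem_of_gaps (σ := -1) (Or.inr rfl) (n := fun j => j)
      (a := fun j => 1 / 3 ^ (j + 1)) (b := fun _ => 1) (fun j => by positivity) (fun _ => le_rfl)
      hpow (fun j => ?_) (fun j τ hτ => ?_) fun j τ hτ h => ?_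
    · rw [ht]
      simpa using pow_mem_wormholeHeights j
    · rw [ht, sub_zero]
      exact (wormholeHeights_subset_Icc hτ).1.trans (le_abs_self _)
    · have := (wormholeHeights_subset_Ioo _ hτ).1
      linarith
  · refine proj_notMem_of_gaps (σ := 1) (Or.inl rfl) (n := fun j => j)
      (a := fun j => 1 / 3 ^ (j + 1)) (b := fun _ => 1) (fun j => by positivity) (fun _ => le_rfl)
      hpow (fun j => ?_) (fun j τ hτ => ?_) fun j τ hτ h => ?_
    · rw [ht, mem_wormholeHeights_iff]
      have h1 : 1 ≤ 3 ^ (j + 1) := Nat.one_le_pow _ _ (by norm_num)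
      have h2 : 3 ∣ 3 ^ (j + 1) := dvd_pow_self 3 (by omega)
      refine ⟨3 ^ (j + 1) - 1, by omega, by omega, ?_⟩
      rw [Nat.cast_sub h1]
      push_cast
      field_simp
    · rw [ht, abs_sub_comm]
      exact le_trans (by linarith [(wormholeHeights_subset_Icc hτ).2]) (le_abs_self _)
    · have := (wormholeHeights_subset_Ioo _ hτ).2
      linarith

theorem maximalityImpliesDiff_eq : maximalityImpliesDiff =
    proj '' {p : IK | (p.1 : ℝ) ∈ comparableHeights} := by
  ext x
  constructor
  · intro hx
    obtain ⟨⟨t, u⟩, rfl⟩ : ∃ p, proj p = x := Quot.exists_rep x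
    refine ⟨(t, u), ?_, rfl⟩
    rw [mem_ofPred_eq, comparableHeights_eq_iUnion]
    by_contra hS
    simp only [mem_iUnion, not_exists] at hS
    rcases t.2.1.eq_or_lt with h0 | h0
    · exact proj_notMem_of_eq_zero_or_eq_one (Or.inl h0.symm) hx
    · rcases t.2.2.eq_or_lt with h1 | h1
      · exact proj_notMem_of_eq_zero_or_eq_one (Or.inr h1) hx
      · exact proj_notMem_of_notMem_iUnion ⟨h0, h1⟩ hS hx
  · rintro ⟨⟨t, u⟩, ht, rfl⟩ f hf ⟨L, hL, hLf⟩
    rw [mem_ofPred_eq, comparableHeights_eq_iUnion] at ht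
    obtain ⟨j, hj⟩ := mem_iUnion.1 ht
    exact isDifferentiableAt_of_mem_separatedHeights hj (lipschitzWith_lipConst hf) hLf hL

/-! ### Porosity and category -/

theorem IsPorous.isNowhereDense {X : Type*} [MetricSpace X] {P : Set X} (hP : IsPorous P) :
    IsNowhereDense P := by
  obtain ⟨ρ, hρ, -, h⟩ := hP
  rw [IsNowhereDense, ← not_nonempty_iff_eq_empty]
  intro hne
  obtain ⟨x₀, hx₀⟩ := hne
  obtain ⟨x, hxU, hxP⟩ := mem_closure_iff.1 (interior_subset hx₀) _ isOpen_interior hx₀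
  obtain ⟨δ, hδ, hball⟩ := Metric.isOpen_iff.1 isOpen_interior x hxU
  obtain ⟨y, hyx, hyδ, hyP⟩ := h x hxP δ hδ
  have hy : y ∈ closure P := interior_subset (hball hyδ)
  obtain ⟨z, hz, hzP⟩ := mem_closure_iff.1 hy _ Metric.isOpen_ball
    (Metric.mem_ball_self (mul_pos hρ (dist_pos.2 hyx)))
  exact (hyP.le ⟨hz, hzP⟩)

/-- Directly above a point `w` of `J_n`, `n ≥ j`, there is an open interval of length
`3 ^ (-n) / (j + 1)` without points of `separatedHeights j`. -/
theorem isPorous_image_separatedHeights (j : ℕ) :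
    IsPorous (proj '' {p : IK | (p.1 : ℝ) ∈ separatedHeights j}) := by
  have hj : (0 : ℝ) ≤ j := j.cast_nonneg
  refine ⟨1 / (6 * (j + 1)), by positivity, ?_, ?_⟩
  · rw [div_lt_one (by positivity)]
    linarith
  rintro _ ⟨⟨t, u⟩, ⟨⟨ht0, ht1⟩, hsep⟩, rfl⟩ δ hδ
  simp only at ht0 ht1 hsep
  obtain ⟨N, hN⟩ := exists_pow_scale (lt_min (half_pos hδ) (sub_pos.2 ht1))
  set n := max N (max j 1) with hn
  have hnj : j ≤ n := (le_max_left _ _).trans (le_max_right _ _)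
  have hn1 : 1 ≤ n := (le_max_right _ _).trans (le_max_right _ _)
  obtain ⟨h1, h2⟩ := le_min_iff.1 (hN n (le_max_left _ _))
  set e : ℝ := 1 / 3 ^ n with he
  have hepos : 0 < e := by positivity
  have e2 : (2 : ℝ) / 3 ^ n = 2 * e := by rw [he]; ring
  have e3 : (3 : ℝ) / 3 ^ n = 3 * e := by rw [he]; ring
  rw [e3] at h1 h2
  obtain ⟨w, hw, hw1, hw2⟩ := exists_mem_wormholeHeights (n := n) (by omega) (a := t)
    (b := t + 2 * e) ht0.le (by linarith) (by rw [e2]; linarith)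
  set r : ℝ := e / (2 * (j + 1)) with hr
  have hr0 : 0 < r := by positivity
  have hre : (j + 1) * (2 * r) = e := by
    rw [hr]
    field_simp
  have hr1 : r ≤ e := by nlinarith
  let s : Icc (0 : ℝ) 1 := ⟨w + r, by linarith, by linarith⟩
  have hs : (s : ℝ) = w + r := rfl
  have hd : dist (proj (s, u)) (proj (t, u)) ≤ 3 * e := by
    refine (dist_proj_le_abs s t u).trans ?_
    rw [hs, abs_of_pos (by linarith)]
    linarith
  refine ⟨proj (s, u), ?_, by linarith, ?_⟩
  · intro h
    have h3 := congrArg height h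
    rw [height_proj, height_proj] at h3
    simp only [hs] at h3
    linarith
  · rw [← disjoint_iff_inter_eq_empty, Set.disjoint_right]
    rintro _ ⟨⟨t', v⟩, ⟨-, hsep'⟩, rfl⟩ hball
    have h4 : |(t' : ℝ) - s| < r := by
      refine (abs_sub_le_dist_proj (t', v) (s, u)).trans_lt (hball.trans_le ?_)
      calc 1 / (6 * ((j : ℝ) + 1)) * dist (proj (s, u)) (proj (t, u))
          ≤ 1 / (6 * ((j : ℝ) + 1)) * (3 * e) := by gcongr
        _ = r := by
          rw [hr]
          field_simp
          norm_num
    rw [hs, abs_lt] at h4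
    have h5 := hsep' n hnj w hw (by simp only; linarith)
    simp only at h5
    rw [abs_of_neg (by linarith), ← he, ← hre] at h5
    have : ((j : ℝ) + 1) * -(w - t') < (j + 1) * (2 * r) := by
      gcongr
      linarith
    linarith

/-! ### Hausdorff measure -/

open Classical in
/-- The indices `k` of the triadic intervals `[k / 3 ^ n, (k + 1) / 3 ^ n)` that contain points of
`separatedHeights j`. -/
noncomputable def separatedCells (j n : ℕ) : Finset ℕ :=
  (Finset.range (3 ^ n)).filter fun k => ∃ t ∈ separatedHeights j, ⌊t * 3 ^ n⌋₊ = k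

theorem mem_separatedCells {j n k : ℕ} : k ∈ separatedCells j n ↔
    k < 3 ^ n ∧ ∃ t ∈ separatedHeights j, ⌊t * 3 ^ n⌋₊ = k := by
  classical
  rw [separatedCells, Finset.mem_filter, Finset.mem_range]

theorem floor_mem_separatedCells {j : ℕ} {t : ℝ} (ht : t ∈ separatedHeights j) (n : ℕ) :
    ⌊t * 3 ^ n⌋₊ ∈ separatedCells j n := by
  refine mem_separatedCells.2 ⟨?_, t, ht, rfl⟩
  rw [Nat.floor_lt (mul_nonneg ht.1.1.le (by positivity))]
  push_cast
  exact mul_lt_of_lt_one_left (by positivity) ht.1.2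

theorem floor_mul_pow_add_div (t : ℝ) (n M : ℕ) :
    ⌊t * 3 ^ (n + M)⌋₊ / 3 ^ M = ⌊t * 3 ^ n⌋₊ := by
  rw [← Nat.floor_div_natCast]
  congr 1
  push_cast
  rw [pow_add]
  field_simp

/-- Each triadic interval `[k / 3 ^ n, (k + 1) / 3 ^ n)` contains `(3 k + 1) / 3 ^ (n + 1)`, a point
of `J_{n+1}`. The subinterval of order `n + m + 1` that starts there contains this point itself,
which can be separated, but the next one contains no point of `separatedHeights j`. -/
theorem floor_mod_ne {j n m : ℕ} (hjn : j ≤ n + 1) (hm : 2 * (j + 1) ≤ 3 ^ m) {t : ℝ}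
    (ht : t ∈ separatedHeights j) : ⌊t * 3 ^ (n + (m + 1))⌋₊ % 3 ^ (m + 1) ≠ 3 ^ m + 1 := by
  intro hmod
  set k := ⌊t * 3 ^ n⌋₊ with hk
  have hkn : k < 3 ^ n :=
    (mem_separatedCells.1 (floor_mem_separatedCells ht n)).1
  have ht0 : 0 ≤ t * 3 ^ (n + (m + 1)) := mul_nonneg ht.1.1.le (by positivity)
  have hfl : ⌊t * 3 ^ (n + (m + 1))⌋₊ = 3 ^ m * (3 * k + 1) + 1 := by
    have := Nat.div_add_mod ⌊t * 3 ^ (n + (m + 1))⌋₊ (3 ^ (m + 1))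
    rw [floor_mul_pow_add_div, hmod, ← hk, pow_succ] at this
    rw [← this]
    ring
  have h1 := Nat.floor_le ht0
  have h2 := Nat.lt_floor_add_one (t * 3 ^ (n + (m + 1)))
  rw [hfl] at h1 h2
  push_cast at h1 h2
  set w : ℝ := ((3 * k + 1 : ℕ) : ℝ) / 3 ^ (n + 1) with hw
  have hwJ : w ∈ wormholeHeights (n + 1) :=
    mem_wormholeHeights_iff.2 ⟨3 * k + 1, by omega, by rw [pow_succ]; omega, rfl⟩
  have hp : (0 : ℝ) < 3 ^ (n + 1) := by positivity
  have hpm : (0 : ℝ) < 3 ^ m := by positivity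
  have hwmul : w * 3 ^ (n + (m + 1)) = 3 ^ m * (3 * k + 1) := by
    rw [hw, show n + (m + 1) = (n + 1) + m by ring, pow_add _ (n + 1)]
    push_cast
    field_simp
  have h3 : 1 ≤ (t - w) * 3 ^ (n + (m + 1)) := by linarith
  have h4 : (t - w) * 3 ^ (n + (m + 1)) < 2 := by linarith
  have hpos : 0 < t - w := pos_of_mul_pos_left (lt_of_lt_of_le one_pos h3) (by positivity)
  have h5 := ht.2 (n + 1) hjn w hwJ (by linarith)
  rw [abs_sub_comm, abs_of_pos hpos, div_le_iff₀ hp] at h5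
  have h6 : (2 : ℝ) * (j + 1) ≤ 3 ^ m := by exact_mod_cast hm
  have h7 : (t - w) * 3 ^ (n + (m + 1)) = (t - w) * 3 ^ (n + 1) * 3 ^ m := by
    rw [show n + (m + 1) = (n + 1) + m by ring, pow_add]
    ring
  rw [h7] at h4
  have h8 : 2 * (j + 1) * ((t - w) * 3 ^ (n + 1)) ≤ (t - w) * 3 ^ (n + 1) * 3 ^ m := by
    rw [mul_comm (_ * _) (3 ^ m : ℝ)]
    gcongr
  linarith

theorem card_separatedCells_add_le {j n m : ℕ} (hjn : j ≤ n + 1) (hm : 2 * (j + 1) ≤ 3 ^ m) :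
    (separatedCells j (n + (m + 1))).card ≤
      (separatedCells j n).card * (3 ^ (m + 1) - 1) := by
  have hlt : 3 ^ m + 1 < 3 ^ (m + 1) := by
    rw [pow_succ]
    omega
  have hcard : ((Finset.range (3 ^ (m + 1))).erase (3 ^ m + 1)).card = 3 ^ (m + 1) - 1 := by
    rw [Finset.card_erase_of_mem (Finset.mem_range.2 hlt), Finset.card_range]
  rw [← hcard, ← Finset.card_product]
  refine Finset.card_le_card_of_injOn (fun k => (k / 3 ^ (m + 1), k % 3 ^ (m + 1))) ?_ ?_
  · intro k hk
    obtain ⟨-, t, ht, rfl⟩ := mem_separatedCells.1 hk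
    refine Finset.mem_product.2 ⟨?_, Finset.mem_erase.2 ⟨floor_mod_ne hjn hm ht, ?_⟩⟩
    · simp only [floor_mul_pow_add_div]
      exact floor_mem_separatedCells ht n
    · exact Finset.mem_range.2 (Nat.mod_lt _ (by positivity))
  · intro k _ l _ hkl
    simp only [Prod.mk.injEq] at hkl
    rw [← Nat.div_add_mod k (3 ^ (m + 1)), hkl.1, hkl.2, Nat.div_add_mod]

theorem card_separatedCells_mul_add_le {j m : ℕ} (hm : 2 * (j + 1) ≤ 3 ^ m) (i : ℕ) :
    (separatedCells j (j + i * (m + 1))).card ≤ 3 ^ j * (3 ^ (m + 1) - 1) ^ i := by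
  induction i with
  | zero =>
    have hsub : separatedCells j j ⊆ Finset.range (3 ^ j) := fun k hk =>
      Finset.mem_range.2 (mem_separatedCells.1 hk).1
    simpa using Finset.card_le_card hsub
  | succ i ih =>
    rw [show j + (i + 1) * (m + 1) = j + i * (m + 1) + (m + 1) by ring, pow_succ, ← mul_assoc]
    refine (card_separatedCells_add_le (by omega) hm).trans ?_
    gcongr

theorem tendsto_card_separatedCells_div (j : ℕ) : ∃ N : ℕ → ℕ, Tendsto N atTop atTop ∧
    Tendsto (fun i => ((separatedCells j (N i)).card : ℝ) / 3 ^ N i) atTop (𝓝 0) := by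
  set m := 2 * (j + 1) with hmdef
  have hm : 2 * (j + 1) ≤ 3 ^ m := (Nat.lt_pow_self (by norm_num)).le
  have hone : 1 ≤ 3 ^ (m + 1) := Nat.one_le_pow _ _ (by norm_num)
  refine ⟨fun i => j + i * (m + 1), ?_, ?_⟩
  · refine tendsto_atTop_mono (fun i => ?_) tendsto_id
    simp only [id]
    nlinarith
  · have hq : Tendsto (fun i : ℕ => (((3 : ℝ) ^ (m + 1) - 1) / 3 ^ (m + 1)) ^ i) atTop (𝓝 0) := by
      have h1 : (1 : ℝ) ≤ 3 ^ (m + 1) := one_le_pow₀ (by norm_num)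
      refine tendsto_pow_atTop_nhds_zero_of_lt_one (div_nonneg (by linarith) (by positivity)) ?_
      rw [div_lt_one (by positivity)]
      linarith
    refine squeeze_zero (fun i => by positivity) (fun i => ?_) hq
    simp only
    have h2 : ((separatedCells j (j + i * (m + 1))).card : ℝ) ≤ 3 ^ j * (3 ^ (m + 1) - 1) ^ i := by
      have := card_separatedCells_mul_add_le hm i
      have h3 : ((separatedCells j (j + i * (m + 1))).card : ℝ) ≤
        ((3 ^ j * (3 ^ (m + 1) - 1) ^ i : ℕ) : ℝ) := by exact_mod_cast this
      rwa [Nat.cast_mul, Nat.cast_pow, Nat.cast_pow, Nat.cast_sub hone, Nat.cast_pow,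
        Nat.cast_one, Nat.cast_ofNat] at h3
    rw [div_le_iff₀ (by positivity), pow_add _ j, mul_comm i (m + 1), pow_mul, div_pow, mul_comm (m + 1) i]
    refine h2.trans (le_of_eq ?_)
    field_simp

/-- The image in `F` of a triadic interval of order `n` times the Cantor set with the first `n`
digits prescribed. -/
def cell (n k : ℕ) (a : Fin n → Bool) : Set LaaksoSpace :=
  proj '' {p : IK | ⌊(p.1 : ℝ) * 3 ^ n⌋₊ = k ∧ ∀ i : Fin n, bits p.2 i = a i}

theorem ediam_cell_le {n k : ℕ} (hk : k < 3 ^ n) (a : Fin n → Bool) :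
    Metric.ediam (cell n k a) ≤ ENNReal.ofReal (3 / 3 ^ n) := by
  refine Metric.ediam_le ?_
  rintro _ ⟨⟨s, u⟩, ⟨hs, hu⟩, rfl⟩ _ ⟨⟨t, v⟩, ⟨ht, hv⟩, rfl⟩
  simp only at hs hu ht hv
  have hp : (0 : ℝ) < 3 ^ n := by positivity
  have hk1 : (k : ℝ) + 1 ≤ 3 ^ n := by exact_mod_cast hk
  let α : Icc (0 : ℝ) 1 := ⟨k / 3 ^ n, by positivity, by rw [div_le_one hp]; linarith⟩
  let β : Icc (0 : ℝ) 1 := ⟨(k + 1) / 3 ^ n, by positivity, by rwa [div_le_one hp]⟩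
  have hα : (α : ℝ) = k / 3 ^ n := rfl
  have hβ : (β : ℝ) = α + 1 / 3 ^ n := add_div _ _ _
  have hmem : ∀ r : Icc (0 : ℝ) 1, ⌊(r : ℝ) * 3 ^ n⌋₊ = k → (α : ℝ) ≤ r ∧ (r : ℝ) ≤ β := by
    intro r hr
    have h1 := Nat.floor_le (mul_nonneg r.2.1 hp.le)
    have h2 := Nat.lt_floor_add_one ((r : ℝ) * 3 ^ n)
    rw [hr] at h1 h2
    exact ⟨(div_le_iff₀ hp).2 h1, ((lt_div_iff₀ hp).2 h2).le⟩
  obtain ⟨s1, s2⟩ := hmem s hs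
  obtain ⟨t1, t2⟩ := hmem t ht
  have d1 : dist (proj (s, u)) (proj (α, u)) ≤ 1 / 3 ^ n := by
    refine (dist_proj_le_abs s α u).trans ?_
    rw [abs_of_nonneg (by linarith)]
    linarith
  have d2 : dist (proj (α, u)) (proj (β, v)) ≤ 1 / 3 ^ n := by
    refine (dist_proj_le_of_le (by rw [hβ]; linarith [one_div_pos.2 hp]) fun i hi => ?_).trans
      (by rw [hβ]; linarith)
    have hin : n ≤ i := by
      by_contra! hlt
      exact hi ((hu ⟨i, hlt⟩).trans (hv ⟨i, hlt⟩).symm)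
    refine exists_mem_wormholeHeights (by omega) α.2.1 β.2.2 ?_
    rw [hβ, add_sub_cancel_left, div_le_div_iff₀ (by positivity) hp, pow_succ]
    have : (3 : ℝ) ^ n ≤ 3 ^ i := pow_le_pow_right₀ (by norm_num) hin
    linarith
  have d3 : dist (proj (β, v)) (proj (t, v)) ≤ 1 / 3 ^ n := by
    refine (dist_proj_le_abs β t v).trans ?_
    rw [abs_of_nonneg (by linarith)]
    linarith
  rw [edist_dist]
  refine ENNReal.ofReal_le_ofReal ?_
  have h4 := dist_triangle4 (proj (s, u)) (proj (α, u)) (proj (β, v)) (proj (t, v))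
  have h5 : (3 : ℝ) / 3 ^ n = 3 * (1 / 3 ^ n) := by ring
  linarith

theorem three_div_pow_rpow (n : ℕ) :
    (3 / 3 ^ n : ℝ) ^ (1 + Real.log 2 / Real.log 3) = 6 / 6 ^ n := by
  have h3 : (3 : ℝ) ^ (1 + Real.log 2 / Real.log 3) = 6 := by
    rw [Real.rpow_add (by norm_num), Real.rpow_one, ← Real.logb,
      Real.rpow_logb (by norm_num) (by norm_num) (by norm_num)]
    norm_num
  rw [Real.div_rpow (by norm_num) (by positivity), h3, ← Real.rpow_natCast, ← Real.rpow_mul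
    (by norm_num), mul_comm, Real.rpow_mul (by norm_num), h3, Real.rpow_natCast]

theorem hausdorffMeasure_image_separatedHeights (j : ℕ) :
    μH[1 + Real.log 2 / Real.log 3] (proj '' {p : IK | (p.1 : ℝ) ∈ separatedHeights j}) = 0 := by
  obtain ⟨N, hN, hlim⟩ := tendsto_card_separatedCells_div j
  have hQ : 0 ≤ 1 + Real.log 2 / Real.log 3 := by
    have h1 := Real.log_pos (show (1 : ℝ) < 2 by norm_num)
    have h2 := Real.log_pos (show (1 : ℝ) < 3 by norm_num)
    positivity
  have hr : Tendsto (fun i => ENNReal.ofReal (3 / 3 ^ N i)) atTop (𝓝 0) := by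
    rw [← ENNReal.ofReal_zero]
    refine (ENNReal.continuous_ofReal.tendsto 0).comp ?_
    have h1 : Tendsto (fun n : ℕ => (3 : ℝ) * (1 / 3) ^ n) atTop (𝓝 0) := by
      simpa using (tendsto_pow_atTop_nhds_zero_of_lt_one (by norm_num : (0 : ℝ) ≤ 1 / 3)
        (by norm_num)).const_mul 3
    refine (h1.comp hN).congr fun i => ?_
    simp only [Function.comp_apply, one_div_pow]
    ring
  have hle := Measure.hausdorffMeasure_le_liminf_sum
    (ι := fun i => separatedCells j (N i) × (Fin (N i) → Bool)) (1 + Real.log 2 / Real.log 3)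
    (proj '' {p : IK | (p.1 : ℝ) ∈ separatedHeights j}) (l := atTop) _ hr
    (fun i c => cell (N i) c.1 c.2)
    (.of_forall fun i c => ediam_cell_le
      (mem_separatedCells.1 c.1.2).1 c.2)
    (.of_forall fun i => by
      rintro _ ⟨⟨t, u⟩, ht, rfl⟩
      exact mem_iUnion.2 ⟨(⟨_, floor_mem_separatedCells ht (N i)⟩, fun l => bits u l),
        (t, u), ⟨rfl, fun _ => rfl⟩, rfl⟩)
  have hsum : ∀ i, ∑ c : separatedCells j (N i) × (Fin (N i) → Bool),
      Metric.ediam (cell (N i) c.1 c.2) ^ (1 + Real.log 2 / Real.log 3) ≤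
        ENNReal.ofReal (6 * (((separatedCells j (N i)).card : ℝ) / 3 ^ N i)) := by
    intro i
    calc ∑ c : separatedCells j (N i) × (Fin (N i) → Bool),
          Metric.ediam (cell (N i) c.1 c.2) ^ (1 + Real.log 2 / Real.log 3)
        ≤ ∑ _c : separatedCells j (N i) × (Fin (N i) → Bool), ENNReal.ofReal (6 / 6 ^ N i) := by
          refine Finset.sum_le_sum fun c _ => ?_
          rw [← three_div_pow_rpow, ← ENNReal.ofReal_rpow_of_pos (by positivity)]
          exact ENNReal.rpow_le_rpow (ediam_cell_le
            (mem_separatedCells.1 c.1.2).1 c.2) hQ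
      _ = ENNReal.ofReal (6 * (((separatedCells j (N i)).card : ℝ) / 3 ^ N i)) := by
          rw [Finset.sum_const, Finset.card_univ, Fintype.card_prod, Fintype.card_coe,
            nsmul_eq_mul, ← ENNReal.ofReal_natCast, ← ENNReal.ofReal_mul (by positivity)]
          congr 1
          simp only [Fintype.card_pi, Fintype.card_bool, Finset.prod_const, Finset.card_univ,
            Fintype.card_fin]
          push_cast
          rw [show (6 : ℝ) ^ N i = 2 ^ N i * 3 ^ N i by rw [← mul_pow]; norm_num]
          field_simp
  have hlim' : Tendsto (fun i => ENNReal.ofReal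
      (6 * (((separatedCells j (N i)).card : ℝ) / 3 ^ N i))) atTop (𝓝 0) := by
    rw [← ENNReal.ofReal_zero]
    refine (ENNReal.continuous_ofReal.tendsto 0).comp ?_
    simpa using hlim.const_mul 6
  refine le_antisymm (hle.trans ?_) zero_le
  exact (liminf_le_liminf (.of_forall hsum)).trans hlim'.liminf_eq.le

theorem maximalityImpliesDiff_eq_iUnion : maximalityImpliesDiff =
    ⋃ j, proj '' {p : IK | (p.1 : ℝ) ∈ separatedHeights j} := by
  rw [maximalityImpliesDiff_eq, comparableHeights_eq_iUnion, ← image_iUnion]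
  congr 1
  ext p
  simp

end Laakso

theorem theorem1p1 :
    Laakso.maximalityImpliesDiff =
        Laakso.proj '' {p : Laakso.IK | (p.1 : ℝ) ∈ Laakso.comparableHeights} ∧
      Laakso.IsSigmaPorous Laakso.maximalityImpliesDiff ∧
      IsMeagre Laakso.maximalityImpliesDiff ∧
      μH[1 + Real.log 2 / Real.log 3] Laakso.maximalityImpliesDiff = 0 := by
  refine ⟨Laakso.maximalityImpliesDiff_eq, ?_⟩
  rw [Laakso.maximalityImpliesDiff_eq_iUnion]
  exact ⟨⟨_, Laakso.isPorous_image_separatedHeights, rfl⟩,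
    isMeagre_iUnion fun j => (Laakso.isPorous_image_separatedHeights j).isNowhereDense.isMeagre,
    measure_iUnion_null Laakso.hausdorffMeasure_image_separatedHeights⟩
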